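/- Let $\Omega\subset\mathbb{R}^2$ be a convex polygonal domain, let $\boldsymbol\zeta=(\zeta_1,\zeta_2)\in[W^{1,\infty}(\Omega)]^2$ (on edges, the values of $\zeta_i$ are those of its representative that is continuous on $\overline\Omega$), and let $\nabla\cdot\boldsymbol\zeta$ be its weak divergence. Let $\mathcal{T}_h$ be a conforming simplicial triangulation of $\Omega$ with numbered triangles, $\mathcal{E}_h$ its set of edges, $\mathcal{E}_h^B$ the edges on $\partial\Omega$ and $\mathcal{E}_h^I=\mathcal{E}_h\setminus\mathcal{E}_h^B$. Let $V_h$ be the space of functions that are affine on each $T\in\mathcal{T}_h$ (no continuity across edges). Put $(v,w)_{\mathcal{T}_h}=\sum_{T\in\mathcal{T}_h}\int_T vw\,dx$ and $\langle v,w\rangle_{\mathcal{S}}=\sum_{e\in\mathcal{S}}\int_e vw\,ds$ for $\mathcal{S}\subset\mathcal{E}_h$. On $e=\partial T^+\cap\partial T^-\in\mathcal{E}_h^I$, where $T^+$ has the larger number, let $\mathbf{n}=(n^{(1)},n^{(2)})$ be the outward unit normal of $T^+$, $v^\pm=v|_{T^\pm}$, $[v]=v^+-v^-$, $\{v\}=\tfrac12(v^++v^-)$,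 and let $\mathcal{Q}_i^\pm(v)$ be $v^\pm$ if $n^{(i)}>0$, $v^\mp$ if $n^{(i)}<0$, and $\{v\}$ if $n^{(i)}=0$. On $e\in\mathcal{E}_h^B$, let $T^+$ be the triangle containing $e$, $\mathbf{n}$ its outward unit normal and $[v]=\{v\}=\mathcal{Q}_i^\pm(v)=v^+$. For a piecewise function $v$ that is continuous on each closed triangle, $\partial^\pm_{h,x_i}v\in V_h$ ($i=1,2$) is defined by $$(\partial_{h,x_i}^\pm v,\varphi_h)_{\mathcal{T}_h}=\langle\mathcal{Q}_i^\pm(v)n^{(i)},[\varphi_h]\rangle_{\mathcal{E}_h}-(v,\partial_{x_i}\varphi_h)_{\mathcal{T}_h}\qquad\forall\varphi_h\in V_h,$$ and $\overline{\mathrm{div}}_h\mathbf{v}=\tfrac12\sum_{i=1}^2(\partial_{h,x_i}^+v^{(i)}+\partial_{h,x_i}^-v^{(i)})$. Then the following hold. 1. (Generalized integration by parts.) For every such $\mathcal{T}_h$, $i\in\{1,2\}$, both choices of sign, and all $v_h,\varphi_h\in V_h$, $$(\partial_{h,x_i}^{\pm}(\zeta_i v_h),\varphi_h)_{\mathcal{T}_h}=-(\partial_{h,x_i}^{\mp}(\zeta_i\varphi_h),v_h)_{\mathcal{T}_h}+(\varphi_h,(\partial_{x_i}\zeta_i)v_h)_{\mathcal{T}_h}+\langle\zeta_i\varphi_h,v_hn^{(i)}\rangle_{\mathcal{E}_h^B}.$$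 Let further $\gamma\in W^{1,\infty}(\Omega)$ and $\partial\Omega^-=\{x\in\partial\Omega:\boldsymbol\zeta\cdot\mathbf{n}<0\}$, and put $$a_h^{ar}(v,w)=(\overline{\mathrm{div}}_h(\boldsymbol\zeta v),w)_{\mathcal{T}_h}+((\gamma-\nabla\cdot\boldsymbol\zeta)v,w)_{L_2(\Omega)}+\int_{\partial\Omega^-}|\boldsymbol\zeta\cdot\mathbf{n}|\,v\,w\,ds,\qquad v,w\in V_h.$$ 2. (Equivalence with the centered-flux DG method.) For every such $\mathcal{T}_h$ and all $v,w\in V_h$, $a_h^{ar}(v,w)=a_h^{cf}(v,w)$, where $$a_h^{cf}(v,w)=(\nabla\cdot(\boldsymbol\zeta v),w)_{\mathcal{T}_h}-\langle\boldsymbol\zeta\cdot\mathbf{n}\,[v],\{w\}\rangle_{\mathcal{E}_h^I}+((\gamma-\nabla\cdot\boldsymbol\zeta)v,w)_{L_2(\Omega)}+\int_{\partial\Omega^-}|\boldsymbol\zeta\cdot\mathbf{n}|\,v\,w\,ds$$ and $\nabla\cdot(\boldsymbol\zeta v)$ in the first term is taken on each triangle separately. Consequently, for all $f\in L_2(\Omega)$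 and $g\in L^1(\partial\Omega)$, a function $u_h\in V_h$ satisfies $a_h^{ar}(u_h,w)=(f,w)_{L_2(\Omega)}+\int_{\partial\Omega^-}|\boldsymbol\zeta\cdot\mathbf{n}|\,g\,w\,ds$ for all $w\in V_h$ if and only if it satisfies the same equations with $a_h^{cf}$ in place of $a_h^{ar}$. 3. ($L_2$ coercivity.) If $\gamma-\tfrac12\nabla\cdot\boldsymbol\zeta\ge\gamma_0$ a.e. in $\Omega$ for a constant $\gamma_0>0$, then there is a constant $C>0$, independent of the triangulation, such that for every such $\mathcal{T}_h$ and all $v_h\in V_h$, $$a_h^{ar}(v_h,v_h)\ge C\Big(\|v_h\|_{L_2(\Omega)}^2+\int_{\partial\Omega}\tfrac12|\boldsymbol\zeta\cdot\mathbf{n}|\,v_h^2\,ds\Big).$$ -/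

import Mathlib

open MeasureTheory Set Filter Topology
open scoped ContDiff

noncomputable section

namespace DGCalc

/-- The Euclidean plane `ℝ²`. -/
abbrev Plane : Type := EuclideanSpace ℝ (Fin 2)

/-- The coordinate direction `x_i`. -/
abbrev coordVec (i : Fin 2) : Plane := EuclideanSpace.single i (1 : ℝ)

/-- A convex polygonal domain: the nonempty interior of the convex hull of finitely many points. -/
def IsConvexPolygonalDomain (Ω : Set Plane) : Prop :=
  Ω.Nonempty ∧ ∃ s : Finset Plane, Ω = interior (convexHull ℝ (s : Set Plane))

/-! ### Sobolev functions -/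

/-- `g` is the weak partial derivative `∂_{x_i} u` on the open set `U`. -/
def IsWeakPartial (U : Set Plane) (i : Fin 2) (u g : Plane → ℝ) : Prop :=
  LocallyIntegrableOn u U ∧ LocallyIntegrableOn g U ∧
    ∀ φ : Plane → ℝ, ContDiff ℝ ∞ φ → HasCompactSupport φ → tsupport φ ⊆ U →
      ∫ x in U, u x * fderiv ℝ φ x (coordVec i) = -∫ x in U, g x * φ x

open Classical in
/-- The weak partial derivative `∂_{x_i} u` on the open set `U` (unique up to a null set when it
exists, and `0` by convention when it does not). -/
def weakPartial (U : Set Plane) (i : Fin 2) (u : Plane → ℝ) : Plane → ℝ :=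
  if h : ∃ g, IsWeakPartial U i u g then h.choose else 0

/-- The Sobolev space `W^{1,∞}(Ω)`. -/
def MemW1Inf (Ω : Set Plane) (u : Plane → ℝ) : Prop :=
  MemLp u ⊤ (volume.restrict Ω) ∧
    ∀ i, ∃ g, MemLp g ⊤ (volume.restrict Ω) ∧ IsWeakPartial Ω i u g

open Classical in
/-- The representative of (the a.e. class on `Ω` of) `u` that is continuous up to the boundary
(unique on `closure Ω` when it exists, and `u` itself by convention when it does not). It gives the
values of a `W^{1,∞}` function on the edges of a mesh. -/
def contRep (Ω : Set Plane) (u : Plane → ℝ) : Plane → ℝ :=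
  if h : ∃ w : Plane → ℝ, ContinuousOn w (closure Ω) ∧ w =ᵐ[volume.restrict Ω] u
  then h.choose else u

/-- The divergence `∇·ζ` of a vector field on `Ω`, in the weak sense. -/
def weakDiv (Ω : Set Plane) (ζ : Fin 2 → Plane → ℝ) (x : Plane) : ℝ :=
  ∑ i, weakPartial Ω i (ζ i) x

/-! ### Triangulations -/

/-- A (conforming) simplicial triangulation of `Ω`: a finite, pure two-dimensional simplicial
complex that fills `closure Ω`, together with a global numbering of its triangles. -/
structure Mesh (Ω : Set Plane) where
  /-- the underlying complex; a face is given by its set of vertices -/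
  K : Geometry.SimplicialComplex ℝ Plane
  finite_faces : K.faces.Finite
  pure : ∀ s ∈ K.faces, ∃ t ∈ K.faces, s ⊆ t ∧ t.card = 3
  space_eq : K.space = closure Ω
  /-- the global numbering -/
  number : Finset Plane → ℕ
  number_injOn : Set.InjOn number {t | t ∈ K.faces ∧ t.card = 3}

variable {Ω : Set Plane}

/-- The triangles of the mesh. -/
def Mesh.Tri (M : Mesh Ω) : Type := {t : Finset Plane // t ∈ M.K.faces ∧ t.card = 3}

/-- The edges of the mesh. -/
def Mesh.Edge (M : Mesh Ω) : Type := {e : Finset Plane // e ∈ M.K.faces ∧ e.card = 2}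

instance (M : Mesh Ω) : Fintype M.Tri :=
  (M.finite_faces.subset (fun _ h => h.1 :
    {t | t ∈ M.K.faces ∧ t.card = 3} ⊆ M.K.faces)).fintype

instance (M : Mesh Ω) : Fintype M.Edge :=
  (M.finite_faces.subset (fun _ h => h.1 :
    {e | e ∈ M.K.faces ∧ e.card = 2} ⊆ M.K.faces)).fintype

/-- The closed triangle `T ⊆ ℝ²`. -/
def Mesh.Tri.region {M : Mesh Ω} (T : M.Tri) : Set Plane := convexHull ℝ (T.1 : Set Plane)

/-- The closed segment `e ⊆ ℝ²`. -/
def Mesh.Edge.region {M : Mesh Ω} (e : M.Edge) : Set Plane := convexHull ℝ (e.1 : Set Plane)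

/-- The boundary edges are the edges that lie on `∂Ω`; all other edges are interior. -/
def Mesh.Edge.IsBoundary {M : Mesh Ω} (e : M.Edge) : Prop := e.region ⊆ frontier Ω

open Classical in
/-- The set of boundary edges. -/
def Mesh.bdryEdges (M : Mesh Ω) : Finset M.Edge := Finset.univ.filter fun e => e.IsBoundary

open Classical in
/-- The set of interior edges. -/
def Mesh.intEdges (M : Mesh Ω) : Finset M.Edge := Finset.univ.filter fun e => ¬ e.IsBoundary

open Classical in
/-- The triangles that have `e` as an edge. -/
def Mesh.Edge.adj {M : Mesh Ω} (e : M.Edge) : Finset M.Tri :=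
  Finset.univ.filter fun T => e.1 ⊆ T.1

theorem Mesh.Edge.adj_nonempty {M : Mesh Ω} (e : M.Edge) : e.adj.Nonempty := by
  obtain ⟨t, ht, hst, hc⟩ := M.pure e.1 e.2.1
  exact ⟨⟨t, ht, hc⟩, Finset.mem_filter.2 ⟨Finset.mem_univ _, hst⟩⟩

/-- `T⁺`: the triangle adjacent to `e` with the largest number. -/
def Mesh.Edge.triPlus {M : Mesh Ω} (e : M.Edge) : M.Tri :=
  (Finset.exists_max_image e.adj (fun T => M.number T.1) e.adj_nonempty).choose

/-- `T⁻`: the triangle adjacent to `e` with the smallest number (only used on interior edges). -/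
def Mesh.Edge.triMinus {M : Mesh Ω} (e : M.Edge) : M.Tri :=
  (Finset.exists_min_image e.adj (fun T => M.number T.1) e.adj_nonempty).choose

/-- `n` is the outward unit normal of the triangle `T` on its edge `e`. -/
def IsOuterNormal {M : Mesh Ω} (T : M.Tri) (e : M.Edge) (n : Plane) : Prop :=
  ‖n‖ = 1 ∧ ∀ x ∈ e.region, ∀ y ∈ T.region, inner ℝ n (y - x) ≤ 0

/-- The unit normal `n_e` of an edge: the outward normal of `T⁺`. -/
def Mesh.Edge.normal {M : Mesh Ω} (e : M.Edge) : Plane :=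
  Classical.epsilon fun n => IsOuterNormal e.triPlus e n

/-! ### Piecewise functions -/

/-- Piecewise functions on the mesh: a function on each closed triangle `T`
(its values outside `T` play no role). -/
abbrev Broken (M : Mesh Ω) : Type := M.Tri → Plane → ℝ

/-- The DG space `V_h` of piecewise `ℙ₁` functions: an affine function on each triangle. -/
abbrev DGSpace (M : Mesh Ω) : Type := M.Tri → (Plane →ᵃ[ℝ] ℝ)

variable {M : Mesh Ω}

/-- A DG function as a piecewise function. -/
def toBroken (v : DGSpace M) : Broken M := fun T x => v T x

/-- The product `z v_h` of (the continuous representative of) a function `z` on `Ω` and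
a DG function. -/
def mulDG (z : Plane → ℝ) (v : DGSpace M) : Broken M := fun T x => contRep Ω z x * v T x

/-- `(v, w)_{𝒯_h}`, the sum of the integrals of `v w` over the triangles. -/
def ip (v w : Broken M) : ℝ := ∑ T : M.Tri, ∫ x in T.region, v T x * w T x

/-- `⟨v, w⟩_S`, the sum of the arc length integrals of `v w` over the edges in `S`. -/
def edgeIp (S : Finset M.Edge) (v w : M.Edge → Plane → ℝ) : ℝ :=
  ∑ e ∈ S, ∫ x in e.region, v e x * w e x ∂(Measure.hausdorffMeasure 1)

open Classical in
/-- The jump `[v]`. -/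
def jump (v : Broken M) (e : M.Edge) (x : Plane) : ℝ :=
  if e.IsBoundary then v e.triPlus x else v e.triPlus x - v e.triMinus x

open Classical in
/-- The average `{v}`. -/
def avg (v : Broken M) (e : M.Edge) (x : Plane) : ℝ :=
  if e.IsBoundary then v e.triPlus x else (v e.triPlus x + v e.triMinus x) / 2

/-- The two sides `+` ("right" limit) and `-` ("left" limit). -/
inductive Side where
  | plus : Side
  | minus : Side

/-- The opposite side: `±` becomes `∓`. -/
def Side.flip : Side → Side
  | .plus => .minus
  | .minus => .plus

open Classical in
/-- The trace operators `𝒬_i^±`. -/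
def traceQ (s : Side) (i : Fin 2) (v : Broken M) (e : M.Edge) (x : Plane) : ℝ :=
  if e.IsBoundary then v e.triPlus x
  else if e.normal i = 0 then avg v e x
  else match s with
    | .plus => if 0 < e.normal i then v e.triPlus x else v e.triMinus x
    | .minus => if 0 < e.normal i then v e.triMinus x else v e.triPlus x

/-- The piecewise partial derivative `∂_{x_i} φ` of a DG function (a constant on each triangle). -/
def partialDG (i : Fin 2) (φ : DGSpace M) : Broken M := fun T _ => (φ T).linear (coordVec i)

/-- The right-hand side `⟨𝒬_i^±(v) n^{(i)}, [φ]⟩_{ℰ_h} - (v, ∂_{x_i} φ)_{𝒯_h}` of the equation that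
defines the discrete partial derivatives. -/
def discretePartialRhs (s : Side) (i : Fin 2) (v : Broken M) (φ : DGSpace M) : ℝ :=
  edgeIp Finset.univ (fun e x => traceQ s i v e x * e.normal i) (jump (toBroken φ))
    - ip v (partialDG i φ)

/-- The discrete partial derivative `∂_{h,x_i}^± v`: the element `w` of `V_h` with
`(w, φ)_{𝒯_h} = ⟨𝒬_i^±(v) n^{(i)}, [φ]⟩_{ℰ_h} - (v, ∂_{x_i} φ)_{𝒯_h}` for all `φ ∈ V_h`. It exists and
is unique whenever `v` is continuous on each closed triangle. -/
def discretePartial (s : Side) (i : Fin 2) (v : Broken M) : DGSpace M :=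
  Classical.epsilon fun w : DGSpace M =>
    ∀ φ : DGSpace M, ip (toBroken w) (toBroken φ) = discretePartialRhs s i v φ

/-- The discrete divergences `div_h^±`. -/
def discreteDiv (s : Side) (v : Fin 2 → Broken M) : DGSpace M :=
  ∑ i, discretePartial s i (v i)

/-- The average discrete divergence. -/
def avgDiv (v : Fin 2 → Broken M) : DGSpace M :=
  (1 / 2 : ℝ) • (discreteDiv .plus v + discreteDiv .minus v)

/-! ### The schemes for the reduced problem -/

/-- `ζ·n_e` on the edge `e`. -/
def normalFlux (ζ : Fin 2 → Plane → ℝ) (e : M.Edge) (x : Plane) : ℝ :=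
  ∑ i, contRep Ω (ζ i) x * e.normal i

/-- The inflow weight: `|ζ·n|` where `ζ·n < 0`, and `0` elsewhere. -/
def inflow (ζ : Fin 2 → Plane → ℝ) (e : M.Edge) : Plane → ℝ :=
  {x | normalFlux ζ e x < 0}.indicator fun x => |normalFlux ζ e x|

/-- The terms `((γ - ∇·ζ) v, w) + ∫_{∂Ω⁻} |ζ·n| v w ds`. -/
def reactionInflow (ζ : Fin 2 → Plane → ℝ) (γ : Plane → ℝ) (v w : DGSpace M) : ℝ :=
  ip (fun T x => (γ x - weakDiv Ω ζ x) * v T x) (toBroken w)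
    + edgeIp M.bdryEdges (fun e x => inflow ζ e x * v e.triPlus x) (fun e x => w e.triPlus x)

/-- The bilinear form `a_h^{ar}` of the scheme with the average discrete divergence. -/
def formAvgDiv (ζ : Fin 2 → Plane → ℝ) (γ : Plane → ℝ) (v w : DGSpace M) : ℝ :=
  ip (toBroken (avgDiv fun i => mulDG (ζ i) v)) (toBroken w) + reactionInflow ζ γ v w

/-- The piecewise divergence `∇·(ζ v)` of the product with a DG function, in the weak sense
on each triangle. -/
def brokenDiv (ζ : Fin 2 → Plane → ℝ) (v : DGSpace M) : Broken M :=
  fun T x => ∑ i, weakPartial (interior T.region) i (mulDG (ζ i) v T) x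

/-- The bilinear form of the centered-flux DG method. -/
def formCentered (ζ : Fin 2 → Plane → ℝ) (γ : Plane → ℝ) (v w : DGSpace M) : ℝ :=
  ip (brokenDiv ζ v) (toBroken w)
    - edgeIp M.intEdges (fun e x => normalFlux ζ e x * jump (toBroken v) e x) (avg (toBroken w))
    + reactionInflow ζ γ v w

/-- The right-hand side `(f, w) + ∫_{∂Ω⁻} |ζ·n| g w ds` of both schemes. -/
def load (ζ : Fin 2 → Plane → ℝ) (f g : Plane → ℝ) (w : DGSpace M) : ℝ :=
  ip (fun _ x => f x) (toBroken w)
    + edgeIp M.bdryEdges (fun e x => inflow ζ e x * g x) (fun e x => w e.triPlus x)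

/-- The square of the norm `‖v‖_ar`: `‖v‖²_{L₂(Ω)} + ∫_{∂Ω} ½ |ζ·n| v² ds`. -/
def arNormSq (ζ : Fin 2 → Plane → ℝ) (v : DGSpace M) : ℝ :=
  ip (toBroken v) (toBroken v)
    + edgeIp M.bdryEdges (fun e x => 1 / 2 * |normalFlux ζ e x| * v e.triPlus x)
        (fun e x => v e.triPlus x)

end DGCalc

end

open MeasureTheory Set Filter Topology
open scoped ContDiff

noncomputable section

namespace DGCalc

/-! All three claims come from one elementwise Gauss–Green formula, `MemW1Inf.gaussGreen`, combined
with pointwise algebra on each edge. Summed over the triangles, the volume integral of the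
derivative of z v φ equals the sum over the edges of z [vφ] n^(i).

Analytically, a W^{1,∞} function on a convex open set agrees a.e. with a globally Lipschitz function
F (`MemW1Inf.exists_lipschitz`). So F gives the edge values, and by Rademacher its line derivatives
are the weak derivatives. On one triangle, Gauss–Green for Lipschitz functions
(`integral_lineDeriv_triangle`) is Fubini along lines parallel to an edge together with the
one-dimensional fundamental theorem of calculus.

Geometrically, a boundary edge has exactly one adjacent triangle, and an interior edge exactly two,
with opposite outward normals (`Mesh.Edge.adj_eq_singleton`, `Mesh.Edge.interior_structure`).
Exchanging the sums over triangles and edges then produces jumps (`Mesh.sum_integral_lineDeriv`).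

Discrete derivatives exist because the L₂ product on the finite-dimensional DG space is
nondegenerate (`discretePartial_spec`). On an interior edge with n^(i) ≠ 0, the traces of opposite
sign satisfy Q^±(v)[φ] + Q^∓(φ)[v] = [vφ], which gives integration by parts. Their mean is {v}, and
{v}[w] = [vw] - [v]{w} gives the centered-flux form. Testing with v itself in the integration by
parts leaves ½(∇·ζ)v² in the volume and ½(ζ·n)v² on the boundary. The inflow term turns the latter
into ½|ζ·n|v², so `formAvgDiv_self` is an identity and coercivity is immediate. -/

/-! ### Weak derivatives and Lipschitz representatives -/

theorem IsWeakPartial.congr {U : Set Plane} {i : Fin 2} {u u' g : Plane → ℝ}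
    (h : IsWeakPartial U i u g) (hu : u =ᵐ[volume.restrict U] u') : IsWeakPartial U i u' g := by
  obtain ⟨h1, h2, h3⟩ := h
  refine ⟨?_, h2, fun φ hφ hc hs => ?_⟩
  · intro x hx
    obtain ⟨s, hs, hi⟩ := h1 x hx
    refine ⟨s ∩ U, inter_mem hs self_mem_nhdsWithin, ?_⟩
    have : IntegrableOn u (s ∩ U) := hi.mono_set inter_subset_left
    exact this.congr (ae_mono (Measure.restrict_mono inter_subset_right le_rfl) hu)
  · rw [← h3 φ hφ hc hs]
    refine integral_congr_ae ?_
    filter_upwards [hu] with x hx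
    rw [hx]

/-- The difference g - g' integrates to zero against every test function supported in U, so the
fundamental lemma of the calculus of variations applies. -/
theorem IsWeakPartial.unique {U : Set Plane} (hU : IsOpen U) {i : Fin 2} {u g g' : Plane → ℝ}
    (h : IsWeakPartial U i u g) (h' : IsWeakPartial U i u g') : g =ᵐ[volume.restrict U] g' := by
  rw [EventuallyEq, ae_restrict_iff' hU.measurableSet]
  have := hU.ae_eq_zero_of_integral_contDiff_smul_eq_zero (μ := volume) (f := g - g')
    (h.2.1.sub h'.2.1) ?_
  · filter_upwards [this] with x hx hxU
    simpa [sub_eq_zero] using hx hxU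
  · intro φ hφ hc hs
    have e : ∫ x in U, g x * φ x = ∫ x in U, g' x * φ x := by
      have := (h.2.2 φ hφ hc hs).symm.trans (h'.2.2 φ hφ hc hs)
      linarith
    have key : ∀ k : Plane → ℝ, LocallyIntegrableOn k U →
        Integrable (fun x => φ x * k x) ∧ ∫ x, φ x * k x = ∫ x in U, k x * φ x := by
      intro k hk
      have hki : IntegrableOn k (tsupport φ) := hk.integrableOn_compact_subset hs hc
      have h0 : ∀ x, x ∉ tsupport φ → φ x * k x = 0 := fun x hx => by
        rw [image_eq_zero_of_notMem_tsupport hx, zero_mul]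
      constructor
      · have : IntegrableOn (fun x => φ x * k x) (tsupport φ) :=
          hki.continuousOn_mul hφ.continuous.continuousOn hc
        rwa [integrableOn_iff_integrable_of_support_subset] at this
        intro x hx
        by_contra hn
        exact hx (h0 x hn)
      · rw [setIntegral_eq_integral_of_forall_compl_eq_zero]
        · simp_rw [mul_comm]
        · intro x hx
          rw [mul_comm, h0 x fun hn => hx (hs hn)]
    obtain ⟨i1, e1⟩ := key g h.2.1
    obtain ⟨i2, e2⟩ := key g' h'.2.1
    simp only [smul_eq_mul, Pi.sub_apply, mul_sub]
    rw [integral_sub i1 i2, e1, e2, e, sub_self]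

theorem IsWeakPartial.weakPartial_ae_eq {U : Set Plane} (hU : IsOpen U) {i : Fin 2}
    {u g : Plane → ℝ} (h : IsWeakPartial U i u g) :
    weakPartial U i u =ᵐ[volume.restrict U] g := by
  have hex : ∃ g, IsWeakPartial U i u g := ⟨g, h⟩
  rw [weakPartial, dif_pos hex]
  exact hex.choose_spec.unique hU h

/-- The product of a Lipschitz function and an affine function has the expected weak derivative. -/
theorem _root_.LipschitzWith.isWeakPartial_mul_affine {K : NNReal} {F : Plane → ℝ}
    (hF : LipschitzWith K F) (U : Set Plane) (i : Fin 2) (p : Plane →ᵃ[ℝ] ℝ) :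
    IsWeakPartial U i (fun x => F x * p x)
      (fun x => lineDeriv ℝ F x (coordVec i) * p x + F x * p.linear (coordVec i)) := by
  have hpc : Continuous p := p.continuous_of_finiteDimensional
  have hFc := hF.continuous
  have hd := hF.locallyIntegrable_lineDeriv (μ := volume) (coordVec i)
  have hdp : LocallyIntegrable (fun x => lineDeriv ℝ F x (coordVec i) * p x) := by
    rw [locallyIntegrable_iff] at hd ⊢
    exact fun k hk => (hd k hk).mul_continuousOn hpc.continuousOn hk
  have hFl : LocallyIntegrable (fun x => F x * p.linear (coordVec i)) :=
    (hFc.mul continuous_const).locallyIntegrable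
  refine ⟨(hFc.mul hpc).locallyIntegrable.locallyIntegrableOn U,
    (hdp.add hFl).locallyIntegrableOn U, fun φ hφ hc hs => ?_⟩
  have hpd : ∀ x, HasFDerivAt p p.linear.toContinuousLinearMap x := fun x =>
    (ContinuousAffineMap.hasFDerivAt (f := (⟨p, hpc⟩ : Plane →ᴬ[ℝ] ℝ)))
  have hps : ContDiff ℝ ∞ p := (⟨p, hpc⟩ : Plane →ᴬ[ℝ] ℝ).contDiff
  have hφs : ∀ x, x ∉ U → φ x = 0 := fun x hx =>
    image_eq_zero_of_notMem_tsupport fun h => hx (hs h)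
  have hdφs : ∀ x, x ∉ U → fderiv ℝ φ x = 0 := fun x hx => by
    have := support_fderiv_subset ℝ (f := φ)
    by_contra hn
    exact hx (hs (this hn))
  rw [setIntegral_eq_integral_of_forall_compl_eq_zero (fun x hx => by simp [hdφs x hx]),
    setIntegral_eq_integral_of_forall_compl_eq_zero (fun x hx => by simp [hφs x hx])]
  -- F * p need not be globally Lipschitz. The affine factor is therefore attached to φ, and
  -- integration by parts is applied to F and the compactly supported p * φ.
  have hg : ContDiff ℝ ∞ (fun x => p x * φ x) := hps.mul hφ
  have hgc : HasCompactSupport (fun x => p x * φ x) := hc.mul_left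
  obtain ⟨D, hD⟩ := (hg.of_le (by simp : (1 : WithTop ℕ∞) ≤ ∞)).lipschitzWith_of_hasCompactSupport hgc
    one_ne_zero
  have key := hF.integral_lineDeriv_mul_eq (μ := volume) hD hgc (coordVec i)
  have hl : ∀ x, lineDeriv ℝ (fun x => p x * φ x) x (-coordVec i)
      = -(p x * fderiv ℝ φ x (coordVec i) + φ x * p.linear (coordVec i)) := by
    intro x
    have h1 := (hpd x).mul (hφ.differentiable (by simp) x).hasFDerivAt
    have h2 := (h1.hasLineDerivAt (-coordVec i)).lineDeriv
    rw [show (fun x => p x * φ x) = ⇑p * φ from rfl, h2]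
    simp
    ring
  simp_rw [hl] at key
  have ic : ∀ k : Plane → ℝ, Continuous k → Integrable fun x => k x * φ x := fun k hk =>
    (hk.mul hφ.continuous).integrable_of_hasCompactSupport hc.mul_left
  have i1 : Integrable fun x => F x * p x * fderiv ℝ φ x (coordVec i) := by
    refine Continuous.integrable_of_hasCompactSupport ?_ ?_
    · exact (hFc.mul hpc).mul ((hφ.continuous_fderiv (by simp)).clm_apply continuous_const)
    · exact (hc.fderiv_apply ℝ (coordVec i)).mul_left
  have i2 : Integrable fun x => F x * p.linear (coordVec i) * φ x :=
    ic _ (hFc.mul continuous_const)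
  have i3 : Integrable fun x => lineDeriv ℝ F x (coordVec i) * (p x * φ x) := by
    have : IntegrableOn (fun x => lineDeriv ℝ F x (coordVec i) * (p x * φ x)) (tsupport φ) :=
      (hd.integrableOn_isCompact hc).mul_continuousOn (hpc.mul hφ.continuous).continuousOn hc
    rwa [integrableOn_iff_integrable_of_support_subset] at this
    intro x hx
    by_contra hn
    exact hx (by simp [image_eq_zero_of_notMem_tsupport hn])
  have e1 : ∫ x, (lineDeriv ℝ F x (coordVec i) * p x + F x * p.linear (coordVec i)) * φ x
      = (∫ x, lineDeriv ℝ F x (coordVec i) * (p x * φ x))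
        + ∫ x, F x * p.linear (coordVec i) * φ x := by
    rw [← integral_add i3 i2]
    congr with x
    ring
  have e2 : ∫ x, -(p x * fderiv ℝ φ x (coordVec i) + φ x * p.linear (coordVec i)) * F x
      = -((∫ x, F x * p x * fderiv ℝ φ x (coordVec i))
        + ∫ x, F x * p.linear (coordVec i) * φ x) := by
    rw [← integral_add i1 i2, ← integral_neg]
    congr with x
    ring
  rw [e1, key, e2]
  ring

open Convolution in
/-- A mollification of a function with bounded weak derivatives on `U` has bounded derivatives at
the points of `U` that stay away from the boundary. -/
theorem norm_fderiv_mollification_le {U : Set Plane} (hU : MeasurableSet U) {u : Plane → ℝ} {K : ℝ}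
    (hu : LocallyIntegrable (U.indicator u))
    (h : ∀ i, ∃ g, IsWeakPartial U i u g ∧ ∀ᵐ x ∂(volume.restrict U), ‖g x‖ ≤ K)
    (φ : ContDiffBump (0 : Plane)) {z : Plane} (hz : Metric.closedBall z φ.rOut ⊆ U) :
    ∃ f' : Plane →L[ℝ] ℝ, ‖f'‖ ≤ 2 * K ∧
      HasFDerivAt (φ.normed volume ⋆[ContinuousLinearMap.lsmul ℝ ℝ, volume] U.indicator u) f' z := by
  set ψ := φ.normed (volume : Measure Plane) with hψ
  set B := (ContinuousLinearMap.lsmul ℝ ℝ : ℝ →L[ℝ] ℝ →L[ℝ] ℝ) with hB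
  have hψs : ContDiff ℝ ∞ ψ := φ.contDiff_normed
  have hψc : HasCompactSupport ψ := φ.hasCompactSupport_normed
  -- The derivative is put on the kernel. The reflected kernel t ↦ ψ (z - t) has support in the
  -- closed ball around z, hence in U, so it is a test function and the derivative moves back to u
  -- as g.
  have hd := hψc.hasFDerivAt_convolution_right B.flip hu (hψs.of_le (by simp)) z
  rw [convolution_flip] at hd
  have hcoord : ∀ i, ‖(U.indicator u ⋆[B.flip.precompR Plane, volume] fderiv ℝ ψ) z
      (coordVec i)‖ ≤ K := by
    intro i
    obtain ⟨g, hg, hgK⟩ := h i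
    rw [convolution_precompR_apply _ hu (hψc.fderiv ℝ) (hψs.continuous_fderiv (by simp)),
      convolution_def]
    set χ : Plane → ℝ := fun t => ψ (z - t) with hχ
    have hχs : ContDiff ℝ ∞ χ := hψs.comp (contDiff_const.sub contDiff_id)
    have hχsupp : Function.support χ ⊆ Metric.closedBall z φ.rOut := by
      intro t ht
      have : z - t ∈ Metric.ball (0 : Plane) φ.rOut := by
        rw [← φ.support_normed_eq (μ := volume)]; exact ht
      rw [mem_ball_zero_iff] at this
      rw [mem_closedBall_iff_norm']
      exact this.le
    have hχt : tsupport χ ⊆ Metric.closedBall z φ.rOut :=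
      closure_minimal hχsupp Metric.isClosed_closedBall
    have hχc : HasCompactSupport χ :=
      (isCompact_closedBall z φ.rOut).of_isClosed_subset (isClosed_tsupport _) hχt
    have hχd : ∀ t, fderiv ℝ χ t (coordVec i) = -fderiv ℝ ψ (z - t) (coordVec i) := by
      intro t
      have h1 : HasFDerivAt (fun t : Plane => z - t) (-ContinuousLinearMap.id ℝ Plane) t :=
        (hasFDerivAt_id t).const_sub z
      have h2 := ((hψs.differentiable (by simp) (z - t)).hasFDerivAt).comp t h1
      rw [show χ = ψ ∘ fun t => z - t from rfl, h2.fderiv]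
      simp
    have hχi : Integrable χ := hχs.continuous.integrable_of_hasCompactSupport hχc
    have e1 : ∫ t, B.flip (U.indicator u t) (fderiv ℝ ψ (z - t) (coordVec i))
        = ∫ x in U, g x * χ x := by
      have := hg.2.2 χ hχs hχc (hχt.trans hz)
      rw [← neg_eq_iff_eq_neg] at this
      rw [← this, ← integral_neg, ← integral_indicator hU]
      congr with t
      by_cases ht : t ∈ U
      · simp [ht, hχd, B, mul_comm]
      · simp [ht, B]
    rw [e1]
    -- The bound K passes to the average because the kernel is nonnegative with total mass one.
    refine (norm_integral_le_of_norm_le (g := fun x => K * χ x)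
      (hχi.integrableOn.const_mul K) ?_).trans ?_
    · filter_upwards [hgK] with x hx
      have h0 : 0 ≤ χ x := φ.nonneg_normed _
      rw [norm_mul, Real.norm_of_nonneg h0]
      gcongr
    · rw [integral_const_mul, setIntegral_eq_integral_of_forall_compl_eq_zero, hχ,
        integral_sub_left_eq_self ψ volume z, φ.integral_normed, mul_one]
      intro x hx
      by_contra hn
      exact hx (hz (hχsupp hn))
  refine ⟨_, ContinuousLinearMap.opNorm_le_bound _ ?_ ?_, hd⟩
  · have := (norm_nonneg _).trans (hcoord 0)
    positivity
  · intro y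
    -- The factor 2 arises here: two coordinates, each bounded by ‖y‖.
    have hy : y = y 0 • coordVec 0 + y 1 • coordVec 1 := by
      ext j; fin_cases j <;> simp
    have hyn : ∀ i, ‖y i‖ ≤ ‖y‖ := fun i => PiLp.norm_apply_le y i
    have hK : 0 ≤ K := (norm_nonneg _).trans (hcoord 0)
    generalize (U.indicator u ⋆[B.flip.precompR Plane, volume] fderiv ℝ ψ) z = f' at hcoord
    calc ‖f' y‖ = ‖y 0 * f' (coordVec 0) + y 1 * f' (coordVec 1)‖ := by
          conv_lhs => rw [hy]
          simp
      _ ≤ ‖y 0‖ * ‖f' (coordVec 0)‖ + ‖y 1‖ * ‖f' (coordVec 1)‖ := by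
          refine (norm_add_le _ _).trans ?_
          simp [norm_mul]
      _ ≤ ‖y‖ * K + ‖y‖ * K := by
          gcongr
          · exact hyn 0
          · exact hcoord 0
          · exact hyn 1
          · exact hcoord 1
      _ = 2 * K * ‖y‖ := by ring

/-- A function in `W^{1,∞}` of a convex open set agrees almost everywhere with a Lipschitz
function. -/
theorem MemW1Inf.exists_lipschitz {U : Set Plane} (hU : IsOpen U) (hc : Convex ℝ U)
    {u : Plane → ℝ} (hu : MemW1Inf U u) :
    ∃ (K : NNReal) (F : Plane → ℝ), LipschitzWith K F ∧ u =ᵐ[volume.restrict U] F := by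
  obtain ⟨hu0, hu1⟩ := hu
  choose g hg hgw using hu1
  set K : ℝ := max (lpNorm (g 0) ⊤ (volume.restrict U)) (lpNorm (g 1) ⊤ (volume.restrict U))
  have hK : 0 ≤ K := le_max_of_le_left lpNorm_nonneg
  have hgK : ∀ i, ∀ᵐ x ∂(volume.restrict U), ‖g i x‖ ≤ K := by
    intro i
    filter_upwards [ae_le_lpNorm_exponent_top (hg i)] with x hx
    refine hx.trans ?_
    fin_cases i
    · exact le_max_left _ _
    · exact le_max_right _ _
  have hul : LocallyIntegrable (U.indicator u) :=
    ((memLp_indicator_iff_restrict hU.measurableSet).2 hu0).locallyIntegrable le_top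
  -- Outer radius equal to twice the inner one: a.e. convergence of the mollifications requires this
  -- ratio to stay bounded.
  let φ : ℕ → ContDiffBump (0 : Plane) := fun n =>
    ⟨1 / ((n : ℝ) + 1), 2 * (1 / ((n : ℝ) + 1)), by positivity, by
      have : 0 < 1 / ((n : ℝ) + 1) := by positivity
      linarith⟩
  have hφ : Tendsto (fun n => (φ n).rOut) atTop (𝓝 0) := by
    have := (tendsto_one_div_add_atTop_nhds_zero_nat (𝕜 := ℝ)).const_mul 2
    rwa [mul_zero] at this
  have hae := ContDiffBump.ae_convolution_tendsto_right_of_locallyIntegrable (K := 2) hφ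
    (.of_forall fun n => le_rfl) hul
  -- S has full measure in U. The Lipschitz bound is proved for u itself on S, as the limit of the
  -- bounds for its mollifications.
  set S : Set Plane := {x | x ∈ U ∧ Tendsto (fun n => (convolution ((φ n).normed volume)
    (U.indicator u) (ContinuousLinearMap.lsmul ℝ ℝ) volume) x) atTop (𝓝 (U.indicator u x))}
    with hS
  have hlip : LipschitzOnWith (2 * K).toNNReal u S := by
    refine LipschitzOnWith.of_dist_le_mul fun x hx y hy => ?_
    rw [Real.coe_toNNReal _ (by positivity), dist_eq_norm, dist_eq_norm]
    have hseg : segment ℝ y x ⊆ U := hc.segment_subset hy.1 hx.1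
    -- By convexity the segment lies in U, and by compactness so does its δ-thickening. Once the
    -- mollification radius is below δ, the gradient bound holds along the whole segment.
    obtain ⟨δ, hδ, hδU⟩ := (segment_eq_image_lineMap ℝ y x ▸ isCompact_Icc.image (by fun_prop) :
      IsCompact (segment ℝ y x)).exists_cthickening_subset_open hU hseg
    have hlim := (hx.2.sub hy.2).norm
    rw [indicator_of_mem hx.1, indicator_of_mem hy.1] at hlim
    refine le_of_tendsto hlim ?_
    filter_upwards [hφ.eventually (gt_mem_nhds hδ)] with n hn
    have hd : ∀ z ∈ segment ℝ y x, Metric.closedBall z (φ n).rOut ⊆ U := fun z hz =>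
      (Metric.closedBall_subset_closedBall hn.le).trans
        ((Metric.closedBall_subset_cthickening hz δ).trans hδU)
    have hb : ∀ z ∈ segment ℝ y x, _ := fun z hz =>
      norm_fderiv_mollification_le hU.measurableSet hul (fun i => ⟨g i, hgw i, hgK i⟩) (φ n)
        (hd z hz)
    choose! f' hf1 hf2 using hb
    exact (convex_segment y x).norm_image_sub_le_of_norm_hasFDerivWithin_le
      (fun z hz => (hf2 z hz).hasFDerivWithinAt) hf1 (left_mem_segment ℝ y x)
      (right_mem_segment ℝ y x)
  obtain ⟨F, hF, hFS⟩ := hlip.extend_real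
  refine ⟨_, F, hF, ?_⟩
  rw [EventuallyEq, ae_restrict_iff' hU.measurableSet]
  filter_upwards [hae] with x hx hxU
  exact hFS ⟨hxU, hx⟩

/-- The continuous representative of a function that agrees almost everywhere with a continuous
function. -/
theorem contRep_eqOn {U : Set Plane} (hU : IsOpen U) {u F : Plane → ℝ} (hF : Continuous F)
    (h : u =ᵐ[volume.restrict U] F) : EqOn (contRep U u) F (closure U) := by
  have hex : ∃ w : Plane → ℝ, ContinuousOn w (closure U) ∧ w =ᵐ[volume.restrict U] u :=
    ⟨F, hF.continuousOn, h.symm⟩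
  rw [contRep, dif_pos hex]
  obtain ⟨h1, h2⟩ := hex.choose_spec
  -- Continuous functions equal a.e. on an open set agree on all of it; density extends this to the
  -- closure.
  have : EqOn hex.choose F U :=
    Measure.eqOn_open_of_ae_eq (h2.trans h) hU (h1.mono subset_closure) hF.continuousOn
  exact this.of_subset_closure h1 hF.continuousOn subset_closure le_rfl

/-! ### Triangles and segments in the plane -/

/-- The cross product of two vectors of the plane. -/
def cross (u v : Plane) : ℝ := u 0 * v 1 - u 1 * v 0

/-- Cramer's rule: the barycentric coordinates of x with respect to b and c are quotients of cross
products. -/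
theorem eq_add_cross_smul {a b c : Plane} (hD : cross (b - a) (c - a) ≠ 0) (x : Plane) :
    x = a + (cross (x - a) (c - a) / cross (b - a) (c - a)) • (b - a)
      + (cross (b - a) (x - a) / cross (b - a) (c - a)) • (c - a) := by
  have h : cross (b - a) (c - a) • (x - a)
      = cross (x - a) (c - a) • (b - a) + cross (b - a) (x - a) • (c - a) := by
    ext j
    fin_cases j <;> simp [cross] <;> ring
  rw [add_assoc, ← sub_eq_iff_eq_add', div_eq_inv_mul, div_eq_inv_mul, mul_smul, mul_smul,
    ← smul_add, ← h, inv_smul_smul₀ hD]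

theorem mem_triangle_iff_exists {a b c x : Plane} :
    x ∈ convexHull ℝ {a, b, c} ↔
      ∃ s t : ℝ, 0 ≤ s ∧ 0 ≤ t ∧ s + t ≤ 1 ∧ x = a + s • (b - a) + t • (c - a) := by
  constructor
  · intro hx
    have hc : Convex ℝ {x : Plane | ∃ s t : ℝ, 0 ≤ s ∧ 0 ≤ t ∧ s + t ≤ 1 ∧
        x = a + s • (b - a) + t • (c - a)} := by
      rintro x ⟨s, t, hs, ht, hst, rfl⟩ y ⟨s', t', hs', ht', hst', rfl⟩ k l hk hl hkl
      refine ⟨k * s + l * s', k * t + l * t', by positivity, by positivity, ?_, ?_⟩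
      · nlinarith [mul_le_mul_of_nonneg_left hst hk, mul_le_mul_of_nonneg_left hst' hl]
      · obtain rfl : k = 1 - l := by linarith
        module
    refine convexHull_min ?_ hc hx
    rintro y (rfl | rfl | rfl)
    · exact ⟨0, 0, by simp⟩
    · exact ⟨1, 0, by simp⟩
    · exact ⟨0, 1, by simp⟩
  · rintro ⟨s, t, hs, ht, hst, rfl⟩
    have hcv := convex_convexHull ℝ ({a, b, c} : Set Plane)
    have ha := subset_convexHull ℝ ({a, b, c} : Set Plane) (show a ∈ _ by simp)
    have hb := subset_convexHull ℝ ({a, b, c} : Set Plane) (show b ∈ _ by simp)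
    have hc := subset_convexHull ℝ ({a, b, c} : Set Plane) (show c ∈ _ by simp)
    have := hcv.sum_mem (t := Finset.univ) (w := ![1 - s - t, s, t]) (z := ![a, b, c])
      (by intro i _; fin_cases i <;> simp <;> linarith) (by simp [Fin.sum_univ_three]; ring)
      (by intro i _; fin_cases i <;> simp <;> assumption)
    convert! this using 1
    simp [Fin.sum_univ_three]
    module

/-- With explicit coordinates, membership becomes three inequalities between continuous functions of
x, suited to perturbation arguments near an edge. -/
theorem mem_triangle_iff {a b c : Plane} (hD : cross (b - a) (c - a) ≠ 0) {x : Plane} :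
    x ∈ convexHull ℝ {a, b, c} ↔
      0 ≤ cross (x - a) (c - a) / cross (b - a) (c - a) ∧
      0 ≤ cross (b - a) (x - a) / cross (b - a) (c - a) ∧
      cross (x - a) (c - a) / cross (b - a) (c - a)
        + cross (b - a) (x - a) / cross (b - a) (c - a) ≤ 1 := by
  rw [mem_triangle_iff_exists]
  constructor
  · rintro ⟨s, t, hs, ht, hst, rfl⟩
    have h1 : cross (a + s • (b - a) + t • (c - a) - a) (c - a) / cross (b - a) (c - a) = s := by
      rw [div_eq_iff hD]; simp [cross]; ring
    have h2 : cross (b - a) (a + s • (b - a) + t • (c - a) - a) / cross (b - a) (c - a) = t := by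
      rw [div_eq_iff hD]; simp [cross]; ring
    rw [h1, h2]
    exact ⟨hs, ht, hst⟩
  · rintro ⟨h1, h2, h3⟩
    exact ⟨_, _, h1, h2, h3, eq_add_cross_smul hD x⟩

/-- The arc length integral over a segment in terms of its affine parametrization. -/
theorem setIntegral_segment {p q : Plane} (hpq : p ≠ q) (F : Plane → ℝ) :
    ∫ x in segment ℝ p q, F x ∂(Measure.hausdorffMeasure 1)
      = ‖q - p‖ * ∫ t in (0 : ℝ)..1, F (p + t • (q - p)) := by
  have hl : 0 < ‖q - p‖ := norm_pos_iff.2 (sub_ne_zero.2 hpq.symm)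
  set f : ℝ → Plane := fun s => p + s • (‖q - p‖⁻¹ • (q - p)) with hf
  have hfi : Isometry f := by
    refine Isometry.of_dist_eq fun s t => ?_
    simp only [hf, dist_add_left]
    rw [dist_eq_norm, ← sub_smul, norm_smul, norm_smul, norm_inv, norm_norm,
      inv_mul_cancel₀ hl.ne', mul_one, dist_eq_norm]
  have hseg : segment ℝ p q = f '' Icc 0 ‖q - p‖ := by
    rw [segment_eq_image']
    ext x
    constructor
    · rintro ⟨t, ht, rfl⟩
      refine ⟨t * ‖q - p‖, ⟨mul_nonneg ht.1 hl.le, mul_le_of_le_one_left hl.le ht.2⟩, ?_⟩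
      simp only [hf, smul_smul]
      rw [mul_assoc, mul_inv_cancel₀ hl.ne', mul_one]
    · rintro ⟨t, ht, rfl⟩
      refine ⟨t / ‖q - p‖, ⟨div_nonneg ht.1 hl.le, (div_le_one hl).2 ht.2⟩, ?_⟩
      simp only [hf, smul_smul]
      rw [div_eq_mul_inv]
  -- The unit-speed parametrization is an isometry, so it carries one-dimensional Hausdorff measure,
  -- that is Lebesgue measure on the line, to arc length.
  have hmap := hfi.map_hausdorffMeasure (d := 1) (Or.inl zero_le_one)
  rw [hausdorffMeasure_real] at hmap
  have hres : (Measure.hausdorffMeasure 1).restrict (segment ℝ p q)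
      = (Measure.map f volume).restrict (segment ℝ p q) := by
    rw [hmap, Measure.restrict_restrict_of_subset]
    rw [hseg]
    exact image_subset_range _ _
  rw [hres, hfi.isClosedEmbedding.measurableEmbedding.setIntegral_map, hseg,
    preimage_image_eq _ hfi.injective, integral_Icc_eq_integral_Ioc,
    ← intervalIntegral.integral_of_le hl.le]
  have := intervalIntegral.mul_integral_comp_mul_left (a := 0) (b := 1)
    (f := fun s => F (f s)) (c := ‖q - p‖)
  rw [mul_zero, mul_one] at this
  rw [← this]
  congr 2 with t
  simp only [hf, smul_smul]
  rw [mul_comm ‖q - p‖, mul_assoc, mul_inv_cancel₀ hl.ne', mul_one]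

/-- Affine change of variables from the reference triangle, with Jacobian the cross product. The
reference triangle is placed in ℝ × ℝ so that Fubini can be used. -/
theorem setIntegral_triangle {a b c : Plane} (hD : cross (b - a) (c - a) ≠ 0) (G : Plane → ℝ) :
    ∫ x in convexHull ℝ {a, b, c}, G x = |cross (b - a) (c - a)| *
      ∫ z in {z : ℝ × ℝ | 0 ≤ z.1 ∧ 0 ≤ z.2 ∧ z.1 + z.2 ≤ 1},
        G (a + z.1 • (b - a) + z.2 • (c - a)) := by
  set A : Plane →ₗ[ℝ] Plane := Matrix.toLin (EuclideanSpace.basisFun (Fin 2) ℝ).toBasis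
    (EuclideanSpace.basisFun (Fin 2) ℝ).toBasis
    !![(b - a) 0, (c - a) 0; (b - a) 1, (c - a) 1] with hA
  have hAx : ∀ x : Plane, A x = x 0 • (b - a) + x 1 • (c - a) := by
    intro x
    ext j
    rw [hA, Matrix.toLin_apply]
    fin_cases j <;> simp [Matrix.mulVec, dotProduct, Fin.sum_univ_two] <;> ring
  have hdet : A.toContinuousLinearMap.det = cross (b - a) (c - a) := by
    rw [ContinuousLinearMap.det, LinearMap.coe_toContinuousLinearMap, hA, LinearMap.det_toLin,
      Matrix.det_fin_two_of, cross]
    ring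
  set f : Plane → Plane := fun x => a + A x with hf
  have hfd : ∀ x, HasFDerivAt f A.toContinuousLinearMap x := fun x =>
    A.toContinuousLinearMap.hasFDerivAt.const_add a
  set R : Set Plane := {x | 0 ≤ x 0 ∧ 0 ≤ x 1 ∧ x 0 + x 1 ≤ 1} with hR
  have hRm : MeasurableSet R := by
    have h1 : IsClosed {x : Plane | 0 ≤ x 0} := isClosed_le continuous_const (by fun_prop)
    have h2 : IsClosed {x : Plane | 0 ≤ x 1} := isClosed_le continuous_const (by fun_prop)
    have h3 : IsClosed {x : Plane | x 0 + x 1 ≤ 1} := isClosed_le (by fun_prop) continuous_const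
    exact (h1.inter (h2.inter h3)).measurableSet
  have himg : f '' R = convexHull ℝ {a, b, c} := by
    ext x
    rw [mem_triangle_iff_exists]
    constructor
    · rintro ⟨y, ⟨h1, h2, h3⟩, rfl⟩
      exact ⟨y 0, y 1, h1, h2, h3, by rw [hf]; simp only; rw [hAx, add_assoc]⟩
    · rintro ⟨s, t, h1, h2, h3, rfl⟩
      refine ⟨!₂[s, t], ⟨by simpa, by simpa, by simpa⟩, ?_⟩
      simp only [hf]; rw [hAx, add_assoc]; simp
  have hinj : InjOn f R := by
    have hu : Function.Injective A := by
      rw [injective_iff_map_eq_zero]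
      intro x hx
      rw [hAx] at hx
      have h0 := congrArg (fun v => cross v (c - a)) hx
      have h1 := congrArg (fun v => cross (b - a) v) hx
      have e0 : x 0 * cross (b - a) (c - a) = 0 := by
        simp [cross] at h0; simp only [cross, PiLp.sub_apply]; linear_combination h0
      have e1 : x 1 * cross (b - a) (c - a) = 0 := by
        simp [cross] at h1; simp only [cross, PiLp.sub_apply]; linear_combination h1
      ext j
      fin_cases j
      · simpa [hD] using e0
      · simpa [hD] using e1
    intro x _ y _ h
    exact hu (add_left_cancel h)
  rw [← himg, integral_image_eq_integral_abs_det_fderiv_smul volume hRm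
    (fun x _ => (hfd x).hasFDerivWithinAt) hinj, hdet]
  simp only [smul_eq_mul]
  rw [integral_const_mul]
  congr 1
  have hmp : MeasurePreserving
      ((MeasurableEquiv.toLp 2 (Fin 2 → ℝ)).symm.trans (MeasurableEquiv.finTwoArrow (α := ℝ))) :=
    (EuclideanSpace.volume_preserving_symm_measurableEquiv_toLp (Fin 2)).trans
      (volume_preserving_finTwoArrow ℝ)
  rw [← hmp.setIntegral_preimage_emb (MeasurableEquiv.measurableEmbedding _)]
  have hpre : (((MeasurableEquiv.toLp 2 (Fin 2 → ℝ)).symm.trans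
      (MeasurableEquiv.finTwoArrow (α := ℝ))) ⁻¹'
        {z : ℝ × ℝ | 0 ≤ z.1 ∧ 0 ≤ z.2 ∧ z.1 + z.2 ≤ 1}) = R := rfl
  rw [hpre]
  refine integral_congr_ae (.of_forall fun x => ?_)
  simp only [hf]
  rw [hAx, ← add_assoc]
  rfl

/-- Integration of a directional derivative over a triangle along the lines parallel to an edge. -/
theorem integral_lineDeriv_triangle_edge {a b c : Plane} (hD : cross (b - a) (c - a) ≠ 0)
    {K : NNReal} {F : Plane → ℝ} (hF : LipschitzWith K F) :
    ∫ x in convexHull ℝ {a, b, c}, lineDeriv ℝ F x (b - a) = |cross (b - a) (c - a)| *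
      ((∫ t in (0 : ℝ)..1, F (b + t • (c - b))) - ∫ t in (0 : ℝ)..1, F (a + t • (c - a))) := by
  rw [setIntegral_triangle hD]
  congr 1
  set R : Set (ℝ × ℝ) := {z | 0 ≤ z.1 ∧ 0 ≤ z.2 ∧ z.1 + z.2 ≤ 1} with hR
  have hRm : MeasurableSet R := by
    have h1 : IsClosed {x : ℝ × ℝ | 0 ≤ x.1} := isClosed_le continuous_const (by fun_prop)
    have h2 : IsClosed {x : ℝ × ℝ | 0 ≤ x.2} := isClosed_le continuous_const (by fun_prop)
    have h3 : IsClosed {x : ℝ × ℝ | x.1 + x.2 ≤ 1} := isClosed_le (by fun_prop) continuous_const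
    exact (h1.inter (h2.inter h3)).measurableSet
  have hRb : R ⊆ Icc (0 : ℝ × ℝ) 1 := by
    rintro ⟨s, t⟩ ⟨h1, h2, h3⟩
    simp only at h1 h2 h3
    exact ⟨⟨h1, h2⟩, ⟨by simp; linarith, by simp; linarith⟩⟩
  set k : ℝ × ℝ → ℝ := fun z => lineDeriv ℝ F (a + z.1 • (b - a) + z.2 • (c - a)) (b - a) with hk
  have hkm : Measurable k :=
    (measurable_lineDeriv hF.continuous (v := b - a)).comp
      (by fun_prop : Continuous fun z : ℝ × ℝ =>
        a + z.1 • (b - a) + z.2 • (c - a)).measurable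
  have hki : IntegrableOn k R := by
    refine Measure.integrableOn_of_bounded (M := K * ‖b - a‖) ?_
      hkm.aestronglyMeasurable (.of_forall fun z => norm_lineDeriv_le_of_lipschitz ℝ hF)
    exact ((measure_mono hRb).trans_lt isCompact_Icc.measure_lt_top).ne
  rw [← integral_indicator hRm]
  have hki' := (integrable_indicator_iff hRm).2 hki
  rw [Measure.volume_eq_prod] at hki' ⊢
  rw [integral_prod_symm _ hki']
  -- The slice at height t is [0, 1 - t]. Its right end lies on the edge from b to c, its left end
  -- on the edge from a to c.
  have hinner : ∀ t : ℝ, ∫ s, R.indicator k (s, t) =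
      (Icc (0 : ℝ) 1).indicator (fun t => F (b + t • (c - b)) - F (a + t • (c - a))) t := by
    intro t
    by_cases ht : t ∈ Icc (0 : ℝ) 1
    · rw [indicator_of_mem ht]
      have h1 : ∀ s, R.indicator k (s, t) = (Icc 0 (1 - t)).indicator (fun s => k (s, t)) s := by
        intro s
        have hiff : (s, t) ∈ R ↔ s ∈ Icc 0 (1 - t) := by
          simp only [hR, mem_ofPred_eq, mem_Icc]
          constructor
          · rintro ⟨h1, h2, h3⟩; exact ⟨h1, by linarith⟩
          · rintro ⟨h1, h2⟩; exact ⟨h1, ht.1, by linarith⟩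
        by_cases hs : s ∈ Icc 0 (1 - t)
        · rw [indicator_of_mem hs, indicator_of_mem (hiff.2 hs)]
        · rw [indicator_of_notMem hs, indicator_of_notMem (fun h => hs (hiff.1 h))]
      simp_rw [h1]
      rw [integral_indicator measurableSet_Icc, integral_Icc_eq_integral_Ioc,
        ← intervalIntegral.integral_of_le (by linarith [ht.2])]
      set φ : ℝ → ℝ := fun s => F (a + s • (b - a) + t • (c - a)) with hφ
      have hφl : LipschitzWith (K * ‖b - a‖₊) φ := by
        refine LipschitzWith.of_dist_le_mul fun s s' => ?_
        refine (hF.dist_le_mul _ _).trans ?_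
        rw [dist_eq_norm, dist_eq_norm]
        have : a + s • (b - a) + t • (c - a) - (a + s' • (b - a) + t • (c - a))
            = (s - s') • (b - a) := by module
        rw [this, norm_smul]
        push_cast
        rw [mul_assoc, mul_comm ‖s - s'‖]
      have hd : ∀ s, k (s, t) = deriv φ s := by
        intro s
        have : (fun r : ℝ => F (a + s • (b - a) + t • (c - a) + r • (b - a)))
            = fun r => φ (s + r) := by
          ext r
          simp only [hφ]
          congr 1
          module
        simp only [hk, lineDeriv]
        rw [this, deriv_comp_const_add, add_zero]
      simp_rw [hd]
      -- A Lipschitz function of one variable is absolutely continuous, so it is recovered from its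
      -- a.e. derivative.
      rw [(hφl.lipschitzOnWith.absolutelyContinuousOnInterval).integral_deriv_eq_sub]
      simp only [hφ]
      congr 2
      · module
      · module
    · rw [indicator_of_notMem ht, ← integral_zero ℝ ℝ]
      congr with s
      refine indicator_of_notMem (fun h => ht ⟨h.2.1, ?_⟩) _
      have h1 := h.1
      have h3 := h.2.2
      simp only at h1 h3
      linarith
  simp_rw [hinner]
  rw [integral_indicator measurableSet_Icc, integral_Icc_eq_integral_Ioc,
    ← intervalIntegral.integral_of_le zero_le_one, intervalIntegral.integral_sub]
  · exact (hF.continuous.comp (by fun_prop)).intervalIntegrable _ _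
  · exact (hF.continuous.comp (by fun_prop)).intervalIntegrable _ _

/-- The outward unit normal of the triangle `p q r` on its edge `p q`. -/
def outNormal (p q r : Plane) : Plane :=
  -(SignType.sign (cross (q - p) (r - p)) * ‖q - p‖⁻¹ : ℝ) • !₂[-(q - p) 1, (q - p) 0]

theorem intervalIntegral_lineMap_symm (p q : Plane) (F : Plane → ℝ) :
    ∫ t in (0 : ℝ)..1, F (p + t • (q - p)) = ∫ t in (0 : ℝ)..1, F (q + t • (p - q)) := by
  have := intervalIntegral.integral_comp_sub_left (a := 0) (b := 1)
    (fun t => F (q + t • (p - q))) 1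
  simp only [sub_self, sub_zero] at this
  rw [← this]
  congr with t
  congr 1
  module

/-- **Gauss–Green formula** on a triangle for Lipschitz functions. -/
theorem integral_lineDeriv_triangle {a b c : Plane} (hD : cross (b - a) (c - a) ≠ 0)
    {K : NNReal} {F : Plane → ℝ} (hF : LipschitzWith K F) (i : Fin 2) :
    ∫ x in convexHull ℝ {a, b, c}, lineDeriv ℝ F x (coordVec i) =
      (∫ x in segment ℝ a b, F x ∂(Measure.hausdorffMeasure 1)) * outNormal a b c i
      + (∫ x in segment ℝ b c, F x ∂(Measure.hausdorffMeasure 1)) * outNormal b c a i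
      + (∫ x in segment ℝ c a, F x ∂(Measure.hausdorffMeasure 1)) * outNormal c a b i := by
  set D := cross (b - a) (c - a) with hDdef
  have hab : a ≠ b := by rintro rfl; simp [hDdef, cross] at hD
  have hbc : b ≠ c := by rintro rfl; exact hD (by simp [hDdef, cross]; ring)
  have hca : c ≠ a := by rintro rfl; simp [hDdef, cross] at hD
  have h1 := integral_lineDeriv_triangle_edge hD hF
  have hD' : cross (c - a) (b - a) = -D := by simp [hDdef, cross]; ring
  have h2 := integral_lineDeriv_triangle_edge (a := a) (b := c) (c := b)
    (by rw [hD']; exact neg_ne_zero.2 hD) hF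
  rw [hD', abs_neg, show ({a, c, b} : Set Plane) = {a, b, c} by rw [pair_comm]] at h2
  rw [← intervalIntegral_lineMap_symm b c F] at h2
  rw [intervalIntegral_lineMap_symm a c F] at h1
  -- The coordinate direction is expanded in the two edge directions, for which the integral is
  -- already known.
  have hcoord := eq_add_cross_smul (a := a) (b := b) (c := c) hD (a + coordVec i)
  rw [add_sub_cancel_left, add_assoc] at hcoord
  replace hcoord := add_left_cancel hcoord
  set α := cross (coordVec i) (c - a) / D with hα
  set β := cross (b - a) (coordVec i) / D with hβ
  have hint : ∀ v, IntegrableOn (fun x => lineDeriv ℝ F x v) (convexHull ℝ {a, b, c}) := fun v =>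
    (hF.locallyIntegrable_lineDeriv v).integrableOn_isCompact
      ((toFinite ({a, b, c} : Set Plane)).isCompact_convexHull ℝ)
  have hlin : ∫ x in convexHull ℝ {a, b, c}, lineDeriv ℝ F x (coordVec i)
      = α * (∫ x in convexHull ℝ {a, b, c}, lineDeriv ℝ F x (b - a))
        + β * ∫ x in convexHull ℝ {a, b, c}, lineDeriv ℝ F x (c - a) := by
    rw [← integral_const_mul, ← integral_const_mul,
      ← integral_add ((hint _).const_mul α) ((hint _).const_mul β)]
    -- By Rademacher, the line derivative is a.e. linear in its direction.
    refine integral_congr_ae (ae_restrict_of_ae ?_)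
    filter_upwards [hF.ae_differentiableAt (μ := volume)] with x hx
    simp only [hx.lineDeriv_eq_fderiv]
    conv_lhs => rw [hcoord]
    simp
  rw [hlin, h1, h2, setIntegral_segment hab, setIntegral_segment hbc, setIntegral_segment hca]
  -- The cross product is invariant under cyclic relabelling, so the three outward normals carry the
  -- same orientation sign.
  have s1 : cross (c - b) (a - b) = D := by simp [hDdef, cross]; ring
  have s2 : cross (a - c) (b - c) = D := by simp [hDdef, cross]; ring
  simp only [outNormal, s1, s2, ← hDdef]
  have n1 : ‖b - a‖ ≠ 0 := norm_ne_zero_iff.2 (sub_ne_zero.2 hab.symm)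
  have n2 : ‖c - b‖ ≠ 0 := norm_ne_zero_iff.2 (sub_ne_zero.2 hbc.symm)
  have n3 : ‖a - c‖ ≠ 0 := norm_ne_zero_iff.2 (sub_ne_zero.2 hca.symm)
  have hs : (|D| : ℝ) = SignType.sign D * D := (sign_mul_self D).symm
  rw [hs, hα, hβ]
  generalize (∫ t in (0 : ℝ)..1, F (a + t • (b - a))) = I1
  generalize (∫ t in (0 : ℝ)..1, F (b + t • (c - b))) = I2
  generalize (∫ t in (0 : ℝ)..1, F (c + t • (a - c))) = I3
  generalize ((SignType.sign D : SignType) : ℝ) = σ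
  fin_cases i <;> simp [cross] <;> field_simp <;> ring

/-! ### Outward normals -/

theorem inner_outNormal (p q r v : Plane) :
    inner ℝ (outNormal p q r) v
      = -(SignType.sign (cross (q - p) (r - p)) * ‖q - p‖⁻¹ : ℝ) * cross (q - p) v := by
  simp [outNormal, cross, PiLp.inner_apply, Fin.sum_univ_two]
  ring

/-- The third vertex enters the normal only through the sign of a cross product, that is, through
its side of the line p q. -/
theorem outNormal_eq_neg {p q r r' : Plane}
    (h : cross (q - p) (r - p) * cross (q - p) (r' - p) < 0) :
    outNormal p q r' = -outNormal p q r := by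
  simp only [outNormal]
  rcases mul_neg_iff.1 h with ⟨h1, h2⟩ | ⟨h1, h2⟩
  · simp [sign_pos h1, sign_neg h2]
  · simp [sign_pos h2, sign_neg h1]

theorem norm_rot (v : Plane) : ‖(!₂[-v 1, v 0] : Plane)‖ = ‖v‖ := by
  rw [EuclideanSpace.norm_eq, EuclideanSpace.norm_eq]
  simp [Fin.sum_univ_two, add_comm]

theorem norm_outNormal {p q r : Plane} (hD : cross (q - p) (r - p) ≠ 0) :
    ‖outNormal p q r‖ = 1 := by
  have hpq : ‖q - p‖ ≠ 0 := by
    rw [norm_ne_zero_iff]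
    intro h
    rw [h] at hD
    simp [cross] at hD
  rw [outNormal, norm_smul, norm_rot, norm_neg, norm_mul, norm_inv, norm_norm]
  rcases lt_or_gt_of_ne hD with h | h
  · simp [sign_neg h, hpq]
  · simp [sign_pos h, hpq]

/-- In the plane only two unit vectors are orthogonal to the edge; the inequality at the third
vertex selects one of them. -/
theorem eq_outNormal {p q r n : Plane} (hD : cross (q - p) (r - p) ≠ 0) (hn : ‖n‖ = 1)
    (h0 : inner ℝ n (q - p) = 0) (h1 : inner ℝ n (r - p) ≤ 0) : n = outNormal p q r := by
  have hpq : 0 < ‖q - p‖ := by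
    rw [norm_pos_iff]
    intro h
    rw [h] at hD
    simp [cross] at hD
  set d := q - p with hd
  set w := r - p
  set l := ‖d‖ with hl
  have hl2 : l ^ 2 = d 0 ^ 2 + d 1 ^ 2 := by
    rw [hl, EuclideanSpace.norm_sq_eq]; simp [Fin.sum_univ_two]
  have hn2 : n 0 ^ 2 + n 1 ^ 2 = 1 := by
    have := EuclideanSpace.norm_sq_eq n
    rw [hn] at this
    simpa [Fin.sum_univ_two] using this.symm
  simp only [PiLp.inner_apply, Fin.sum_univ_two, RCLike.inner_apply, conj_trivial] at h0 h1
  -- k is the component of n along the rotated edge vector. Lagrange's identity gives |k| = l, and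
  -- the inequality at r fixes the sign.
  set k := n 1 * d 0 - n 0 * d 1 with hk
  have hn0 : l ^ 2 * n 0 = -k * d 1 := by rw [hl2]; linear_combination (d 0) * h0
  have hn1 : l ^ 2 * n 1 = k * d 0 := by rw [hl2]; linear_combination (d 1) * h0
  have hk2 : k ^ 2 = l ^ 2 := by
    have : k ^ 2 + (d 0 * n 0 + d 1 * n 1) ^ 2 = (n 0 ^ 2 + n 1 ^ 2) * (d 0 ^ 2 + d 1 ^ 2) := by
      rw [hk]; ring
    rw [h0, hn2, ← hl2] at this
    linarith
  have hkD : k * cross d w ≤ 0 := by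
    have : k * cross d w = l ^ 2 * (w 0 * n 0 + w 1 * n 1) := by
      simp only [cross]
      linear_combination (-w 0) * hn0 + (-w 1) * hn1
    rw [this]
    exact mul_nonpos_of_nonneg_of_nonpos (sq_nonneg l) h1
  have hksl : k = -(SignType.sign (cross d w) : ℝ) * l := by
    rcases sq_eq_sq_iff_eq_or_eq_neg.1 hk2 with h | h
    · have : cross d w < 0 := by
        refine lt_of_le_of_ne ?_ hD
        rw [h] at hkD
        exact nonpos_of_mul_nonpos_right hkD hpq
      rw [sign_neg this]; simp [h]
    · have : 0 < cross d w := by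
        refine lt_of_le_of_ne ?_ hD.symm
        rw [h] at hkD
        nlinarith
      rw [sign_pos this]; simp [h]
  have hl0 : l ≠ 0 := hpq.ne'
  change n = -((SignType.sign (cross d w) : ℝ) * l⁻¹) • (!₂[-d 1, d 0] : Plane)
  ext j
  generalize ((SignType.sign (cross d w) : SignType) : ℝ) = σ at hksl
  fin_cases j
  · simp
    field_simp
    have := hn0
    rw [hksl] at this
    have h3 : l * (l * n 0 - σ * d 1) = 0 := by linear_combination this
    rcases mul_eq_zero.1 h3 with h | h
    · exact absurd h hl0
    · linarith
  · simp
    field_simp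
    have := hn1
    rw [hksl] at this
    have h3 : l * (l * n 1 + σ * d 0) = 0 := by linear_combination this
    rcases mul_eq_zero.1 h3 with h | h
    · exact absurd h hl0
    · linarith

/-! ### Vertices of triangles and edges -/

/-- A vanishing cross product would make c - a a multiple of b - a, hence the three vertices
collinear. -/
theorem cross_ne_zero_of_affineIndependent {t : Finset Plane}
    (ht : AffineIndependent ℝ ((↑) : t → Plane)) {a b c : Plane} (ha : a ∈ t) (hb : b ∈ t)
    (hc : c ∈ t) (hab : a ≠ b) (hac : a ≠ c) (hbc : b ≠ c) : cross (b - a) (c - a) ≠ 0 := by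
  have hinj : Function.Injective ![(⟨a, ha⟩ : t), ⟨b, hb⟩, ⟨c, hc⟩] := by
    intro i j hij
    fin_cases i <;> fin_cases j <;> simp_all [Subtype.ext_iff, eq_comm]
  have h1 := ht.comp_embedding ⟨_, hinj⟩
  have h2 : ((↑) : t → Plane) ∘ (⟨_, hinj⟩ : Fin 3 ↪ t) = ![a, b, c] := by
    ext i j
    fin_cases i <;> rfl
  rw [h2, affineIndependent_iff_not_collinear_set] at h1
  intro h0
  apply h1
  rw [collinear_iff_of_mem (p₀ := a) (by simp)]
  have hd : (b - a) 0 ≠ 0 ∨ (b - a) 1 ≠ 0 := by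
    by_contra! h
    apply hab
    ext j
    fin_cases j
    · have := h.1; simp at this; simp; linarith
    · have := h.2; simp at this; simp; linarith
  have hk : ∃ k : ℝ, c - a = k • (b - a) := by
    simp only [cross] at h0
    rcases hd with h | h
    · refine ⟨(c - a) 0 / (b - a) 0, ?_⟩
      ext j
      fin_cases j
      · rw [PiLp.smul_apply, smul_eq_mul]; exact (div_mul_cancel₀ _ h).symm
      · rw [PiLp.smul_apply, smul_eq_mul, div_mul_eq_mul_div, eq_div_iff h]
        simp only [Fin.mk_one]
        linarith
    · refine ⟨(c - a) 1 / (b - a) 1, ?_⟩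
      ext j
      fin_cases j
      · rw [PiLp.smul_apply, smul_eq_mul, div_mul_eq_mul_div, eq_div_iff h]
        simp only [Fin.zero_eta]
        linarith
      · rw [PiLp.smul_apply, smul_eq_mul]; exact (div_mul_cancel₀ _ h).symm
  obtain ⟨k, hk⟩ := hk
  refine ⟨b - a, ?_⟩
  rintro p (rfl | rfl | rfl)
  · exact ⟨0, by simp⟩
  · exact ⟨1, by simp⟩
  · exact ⟨k, by rw [← hk]; simp⟩

variable {Ω : Set Plane} {M : Mesh Ω}

theorem Mesh.Tri.exists_vertices (T : M.Tri) :
    ∃ a b c, T.1 = {a, b, c} ∧ a ≠ b ∧ a ≠ c ∧ b ≠ c ∧ cross (b - a) (c - a) ≠ 0 := by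
  obtain ⟨a, b, c, hab, hac, hbc, h⟩ := Finset.card_eq_three.1 T.2.2
  exact ⟨a, b, c, h, hab, hac, hbc, cross_ne_zero_of_affineIndependent (M.K.indep T.2.1)
    (by simp [h]) (by simp [h]) (by simp [h]) hab hac hbc⟩

theorem Mesh.Tri.region_eq {T : M.Tri} {a b c : Plane} (h : T.1 = {a, b, c}) :
    T.region = convexHull ℝ {a, b, c} := by
  rw [Mesh.Tri.region, h]; simp

theorem Mesh.Edge.exists_vertices (e : M.Edge) : ∃ a b, a ≠ b ∧ e.1 = {a, b} :=
  Finset.card_eq_two.1 e.2.2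

theorem Mesh.Edge.region_eq {e : M.Edge} {a b : Plane} (h : e.1 = {a, b}) :
    e.region = segment ℝ a b := by
  rw [Mesh.Edge.region, h]; simp [convexHull_pair]

theorem Mesh.Edge.exists_third_vertex {e : M.Edge} {a b : Plane} (hab : a ≠ b) (he : e.1 = {a, b})
    {T : M.Tri} (hT : e.1 ⊆ T.1) :
    ∃ c, T.1 = {a, b, c} ∧ c ≠ a ∧ c ≠ b ∧ cross (b - a) (c - a) ≠ 0 := by
  classical
  have h1 : (T.1 \ e.1).card = 1 := by
    rw [Finset.card_sdiff_of_subset hT, T.2.2, e.2.2]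
  obtain ⟨c, hc⟩ := Finset.card_eq_one.1 h1
  have hcm : c ∈ T.1 \ e.1 := by rw [hc]; simp
  rw [Finset.mem_sdiff, he] at hcm
  have hca : c ≠ a := by rintro rfl; simp at hcm
  have hcb : c ≠ b := by rintro rfl; simp at hcm
  have hT' : T.1 = {a, b, c} := by
    rw [← Finset.union_sdiff_of_subset hT, hc, he]
    ext x; simp
  exact ⟨c, hT', hca, hcb, cross_ne_zero_of_affineIndependent (M.K.indep T.2.1)
    (by simp [hT']) (by simp [hT']) (by simp [hT']) hab hca.symm hcb.symm⟩

theorem Mesh.Edge.mem_adj {e : M.Edge} {T : M.Tri} : T ∈ e.adj ↔ e.1 ⊆ T.1 := by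
  simp [Mesh.Edge.adj]

/-- Testing at the vertices forces the explicit normal. Conversely, a displacement from the edge to
a point of the triangle has cross product t times that of c - a, with t ≥ 0. This makes the chosen
`Mesh.Edge.normal` computable. -/
theorem isOuterNormal_iff {T : M.Tri} {e : M.Edge} {a b c : Plane} (he : e.1 = {a, b})
    (hT : T.1 = {a, b, c}) (hD : cross (b - a) (c - a) ≠ 0) {n : Plane} :
    IsOuterNormal T e n ↔ n = outNormal a b c := by
  rw [IsOuterNormal, Mesh.Edge.region_eq he, Mesh.Tri.region_eq hT]
  constructor
  · rintro ⟨h1, h2⟩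
    have ha : a ∈ convexHull ℝ {a, b, c} := subset_convexHull ℝ _ (by simp)
    have hb : b ∈ convexHull ℝ {a, b, c} := subset_convexHull ℝ _ (by simp)
    have hc : c ∈ convexHull ℝ {a, b, c} := subset_convexHull ℝ _ (by simp)
    refine eq_outNormal hD h1 (le_antisymm (h2 a (left_mem_segment ℝ a b) b hb) ?_)
      (h2 a (left_mem_segment ℝ a b) c hc)
    have := h2 b (right_mem_segment ℝ a b) a ha
    rw [← neg_sub b a, inner_neg_right] at this
    linarith
  · rintro rfl
    refine ⟨norm_outNormal hD, fun x hx y hy => ?_⟩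
    rw [segment_eq_image'] at hx
    obtain ⟨s, -, rfl⟩ := hx
    obtain ⟨s', t, -, ht, -, rfl⟩ := mem_triangle_iff_exists.1 hy
    have : cross (b - a) (a + s' • (b - a) + t • (c - a) - (a + s • (b - a)))
        = t * cross (b - a) (c - a) := by
      simp [cross]; ring
    rw [inner_outNormal, this]
    have h1 := sign_mul_self (cross (b - a) (c - a))
    have h2 : 0 ≤ ‖b - a‖⁻¹ * t * |cross (b - a) (c - a)| := by positivity
    rw [← h1] at h2
    linarith

theorem Mesh.Edge.triPlus_mem (e : M.Edge) : e.1 ⊆ e.triPlus.1 :=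
  Mesh.Edge.mem_adj.1
    (Finset.exists_max_image e.adj (fun T => M.number T.1) e.adj_nonempty).choose_spec.1

theorem Mesh.Edge.triMinus_mem (e : M.Edge) : e.1 ⊆ e.triMinus.1 :=
  Mesh.Edge.mem_adj.1
    (Finset.exists_min_image e.adj (fun T => M.number T.1) e.adj_nonempty).choose_spec.1

theorem Mesh.Edge.region_subset {e : M.Edge} {T : M.Tri} (h : e.1 ⊆ T.1) :
    e.region ⊆ T.region := convexHull_mono (by exact_mod_cast h)

theorem Mesh.Edge.isOuterNormal_normal (e : M.Edge) : IsOuterNormal e.triPlus e e.normal := by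
  obtain ⟨a, b, hab, he⟩ := e.exists_vertices
  obtain ⟨c, hT, -, -, hD⟩ := Mesh.Edge.exists_third_vertex hab he e.triPlus_mem
  have : ∃ n, IsOuterNormal e.triPlus e n := ⟨_, (isOuterNormal_iff he hT hD).2 rfl⟩
  exact Classical.epsilon_spec this

/-- The Gauss–Green formula on a triangle of a mesh. -/
theorem Mesh.Tri.integral_lineDeriv (T : M.Tri) {K : NNReal} {F : Plane → ℝ}
    (hF : LipschitzWith K F) (i : Fin 2) {ν : M.Edge → Plane}
    (hν : ∀ e : M.Edge, e.1 ⊆ T.1 → IsOuterNormal T e (ν e)) :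
    ∫ x in T.region, lineDeriv ℝ F x (coordVec i) =
      ∑ e : M.Edge with e.1 ⊆ T.1,
        (∫ x in e.region, F x ∂(Measure.hausdorffMeasure 1)) * ν e i := by
  classical
  obtain ⟨a, b, c, hT, hab, hac, hbc, hD⟩ := T.exists_vertices
  have hface : ∀ s : Finset Plane, s ⊆ T.1 → s.card = 2 → s ∈ M.K.faces ∧ s.card = 2 :=
    fun s hs hc => ⟨M.K.down_closed T.2.1 hs (Finset.card_pos.1 (by omega)), hc⟩
  let e₁ : M.Edge := ⟨{a, b}, hface _ (by rw [hT]; intro x; simp; tauto) (Finset.card_pair hab)⟩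
  let e₂ : M.Edge := ⟨{b, c}, hface _ (by rw [hT]; intro x; simp; tauto) (Finset.card_pair hbc)⟩
  let e₃ : M.Edge := ⟨{c, a}, hface _ (by rw [hT]; intro x; simp; tauto)
    (Finset.card_pair hac.symm)⟩
  have h12 : e₁ ≠ e₂ := by
    intro h
    have : a ∈ e₂.1 := h ▸ (by simp [e₁])
    simp [e₂, hab, hac] at this
  have h13 : e₁ ≠ e₃ := by
    intro h
    have : b ∈ e₃.1 := h ▸ (by simp [e₁])
    simp [e₃, hab.symm, hbc] at this
  have h23 : e₂ ≠ e₃ := by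
    intro h
    have : b ∈ e₃.1 := h ▸ (by simp [e₂])
    simp [e₃, hab.symm, hbc] at this
  have hfilter : (Finset.univ.filter fun e : M.Edge => e.1 ⊆ T.1) = {e₁, e₂, e₃} := by
    ext e
    simp only [Finset.mem_filter, Finset.mem_univ, true_and, Finset.mem_insert,
      Finset.mem_singleton]
    constructor
    · intro h
      obtain ⟨x, y, hxy, he⟩ := e.exists_vertices
      rw [he, hT] at h
      have hx : x = a ∨ x = b ∨ x = c := by simpa using h (show x ∈ _ by simp)
      have hy : y = a ∨ y = b ∨ y = c := by simpa using h (show y ∈ _ by simp)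
      have he1 : e.1 = {a, b} → e = e₁ := fun h => Subtype.ext h
      have he2 : e.1 = {b, c} → e = e₂ := fun h => Subtype.ext h
      have he3 : e.1 = {c, a} → e = e₃ := fun h => Subtype.ext h
      rcases hx with rfl | rfl | rfl <;> rcases hy with rfl | rfl | rfl
      · exact absurd rfl hxy
      · exact Or.inl (he1 he)
      · exact Or.inr (Or.inr (he3 (he.trans (Finset.pair_comm _ _))))
      · exact Or.inl (he1 (he.trans (Finset.pair_comm _ _)))
      · exact absurd rfl hxy
      · exact Or.inr (Or.inl (he2 he))
      · exact Or.inr (Or.inr (he3 he))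
      · exact Or.inr (Or.inl (he2 (he.trans (Finset.pair_comm _ _))))
      · exact absurd rfl hxy
    · rintro (rfl | rfl | rfl) <;> rw [hT] <;> intro x <;> simp [e₁, e₂, e₃] <;> tauto
  have hs1 : e₁.1 ⊆ T.1 := by rw [hT]; intro x; simp [e₁]; tauto
  have hs2 : e₂.1 ⊆ T.1 := by rw [hT]; intro x; simp [e₂]; tauto
  have hs3 : e₃.1 ⊆ T.1 := by rw [hT]; intro x; simp [e₃]; tauto
  have hT2 : T.1 = {b, c, a} := by rw [hT]; ext x; simp; tauto
  have hT3 : T.1 = {c, a, b} := by rw [hT]; ext x; simp; tauto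
  have hD2 : cross (c - b) (a - b) ≠ 0 := by
    convert! hD using 1; simp [cross]; ring
  have hD3 : cross (a - c) (b - c) ≠ 0 := by
    convert! hD using 1; simp [cross]; ring
  rw [hfilter, Finset.sum_insert (by simp [h12, h13]), Finset.sum_insert (by simp [h23]),
    Finset.sum_singleton, (isOuterNormal_iff (e := e₁) rfl hT hD).1 (hν _ hs1),
    (isOuterNormal_iff (e := e₂) rfl hT2 hD2).1 (hν _ hs2),
    (isOuterNormal_iff (e := e₃) rfl hT3 hD3).1 (hν _ hs3),
    Mesh.Edge.region_eq (e := e₁) rfl, Mesh.Edge.region_eq (e := e₂) rfl,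
    Mesh.Edge.region_eq (e := e₃) rfl, Mesh.Tri.region_eq hT, integral_lineDeriv_triangle hD hF]
  ring

/-! ### Adjacency of triangles and edges -/

theorem continuous_cross : Continuous fun z : Plane × Plane => cross z.1 z.2 := by
  unfold cross
  fun_prop

/-- At a relative interior point of the edge the other two barycentric inequalities are strict and
persist nearby, so the triangle contains a half-disc there. -/
theorem eventually_mem_triangle {a b c : Plane} (hD : cross (b - a) (c - a) ≠ 0) {r : ℝ}
    (h0 : 0 < r) (h1 : r < 1) :
    ∀ᶠ x in 𝓝 (a + r • (b - a)), 0 ≤ cross (b - a) (x - a) / cross (b - a) (c - a) →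
      x ∈ convexHull ℝ {a, b, c} := by
  have e1 : cross (a + r • (b - a) - a) (c - a) / cross (b - a) (c - a) = r := by
    rw [div_eq_iff hD]; simp [cross]; ring
  have e2 : cross (b - a) (a + r • (b - a) - a) / cross (b - a) (c - a) = 0 := by
    rw [div_eq_iff hD]; simp [cross]; ring
  have c1 : Continuous fun x : Plane => cross (x - a) (c - a) / cross (b - a) (c - a) :=
    (continuous_cross.comp (by fun_prop : Continuous fun x : Plane => (x - a, c - a))).div_const _
  have c2 : Continuous fun x : Plane => cross (b - a) (x - a) / cross (b - a) (c - a) :=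
    (continuous_cross.comp (by fun_prop : Continuous fun x : Plane => (b - a, x - a))).div_const _
  have n1 : ∀ᶠ x in 𝓝 (a + r • (b - a)), 0 < cross (x - a) (c - a) / cross (b - a) (c - a) :=
    c1.continuousAt.eventually (lt_mem_nhds (by beta_reduce; rwa [e1]))
  have n2 : ∀ᶠ x in 𝓝 (a + r • (b - a)), cross (x - a) (c - a) / cross (b - a) (c - a)
      + cross (b - a) (x - a) / cross (b - a) (c - a) < 1 :=
    (c1.add c2).continuousAt.eventually (gt_mem_nhds (by simpa only [Pi.add_apply, e1, e2, add_zero] using h1))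
  filter_upwards [n1, n2] with x hx1 hx2 hx
  exact (mem_triangle_iff hD).2 ⟨le_of_lt hx1, hx, le_of_lt hx2⟩

theorem cross_eq_zero_of_mem_segment {a b x : Plane} (hx : x ∈ segment ℝ a b) :
    cross (b - a) (x - a) = 0 := by
  rw [segment_eq_image'] at hx
  obtain ⟨s, -, rfl⟩ := hx
  simp [cross]; ring

/-- Two triangles of a mesh on the same side of a common edge are equal. -/
theorem Mesh.Tri.eq_of_same_side {T T' : M.Tri} {a b c c' : Plane} (hT : T.1 = {a, b, c})
    (hT' : T'.1 = {a, b, c'}) (hca : c ≠ a) (hcb : c ≠ b)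
    (h : 0 < cross (b - a) (c - a) * cross (b - a) (c' - a)) : T = T' := by
  by_contra hne
  have hD : cross (b - a) (c - a) ≠ 0 := by rintro h0; simp [h0] at h
  have hD' : cross (b - a) (c' - a) ≠ 0 := by rintro h0; simp [h0] at h
  have hcc : c ≠ c' := by
    rintro rfl
    exact hne (Subtype.ext (hT.trans hT'.symm))
  have hsub : (T.1 ∩ T'.1 : Set Plane) ⊆ {a, b} := by
    rintro x ⟨hx, hx'⟩
    rw [hT] at hx
    rw [hT'] at hx'
    simp only [Finset.coe_insert, Finset.coe_singleton, mem_insert_iff, mem_singleton_iff]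
      at hx hx' ⊢
    rcases hx with rfl | rfl | rfl
    · simp
    · simp
    · simp_all
  -- Moving the midpoint of the edge slightly towards c gives a point of both triangles. Conformity
  -- would put it in the hull of the common vertices, hence on the edge.
  have hlim : Tendsto (fun t : ℝ => a + (1 / 2 : ℝ) • (b - a) + t • (c - a)) (𝓝[>] 0)
      (𝓝 (a + (1 / 2 : ℝ) • (b - a))) := by
    have hc : Continuous fun t : ℝ => a + (1 / 2 : ℝ) • (b - a) + t • (c - a) := by fun_prop
    have := hc.tendsto 0
    simp only [zero_smul, add_zero] at this
    exact this.mono_left nhdsWithin_le_nhds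
  have e1 := hlim.eventually (eventually_mem_triangle hD (r := 1 / 2) (by norm_num) (by norm_num))
  have e2 := hlim.eventually (eventually_mem_triangle hD' (r := 1 / 2) (by norm_num) (by norm_num))
  obtain ⟨t, h1, h2, ht⟩ := (e1.and (e2.and self_mem_nhdsWithin)).exists
  replace ht : 0 < t := ht
  have hcr : cross (b - a) (a + (1 / 2 : ℝ) • (b - a) + t • (c - a) - a)
      = t * cross (b - a) (c - a) := by
    simp [cross]; ring
  rw [hcr] at h1 h2
  have m1 := h1 (by rw [mul_div_assoc, div_self hD]; linarith)
  have m2 := h2 (by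
    have : t * cross (b - a) (c - a) / cross (b - a) (c' - a)
        = t * (cross (b - a) (c - a) * cross (b - a) (c' - a)) / cross (b - a) (c' - a) ^ 2 := by
      field_simp
    rw [this]; positivity)
  have m3 := M.K.inter_subset_convexHull T.2.1 T'.2.1
    ⟨(Mesh.Tri.region_eq hT).ge m1, (Mesh.Tri.region_eq hT').ge m2⟩
  have m4 := convexHull_mono hsub m3
  rw [convexHull_pair] at m4
  have := cross_eq_zero_of_mem_segment m4
  rw [hcr] at this
  exact (mul_ne_zero ht.ne' hD) this

theorem Mesh.Tri.region_subset_closure (T : M.Tri) : T.region ⊆ closure Ω := by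
  rw [← M.space_eq]
  exact Geometry.SimplicialComplex.convexHull_subset_space T.2.1

/-- An edge with triangles on both sides meets the domain. -/
theorem Mesh.Edge.not_isBoundary_of_opposite (hΩ : interior (closure Ω) = Ω) {e : M.Edge}
    {T T' : M.Tri} {a b c c' : Plane} (he : e.1 = {a, b}) (hT : T.1 = {a, b, c})
    (hT' : T'.1 = {a, b, c'}) (h : cross (b - a) (c - a) * cross (b - a) (c' - a) < 0) :
    ¬ e.IsBoundary := by
  have hD : cross (b - a) (c - a) ≠ 0 := by rintro h0; simp [h0] at h
  have hD' : cross (b - a) (c' - a) ≠ 0 := by rintro h0; simp [h0] at h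
  -- The half-discs of the two triangles together form a neighbourhood of the edge midpoint inside
  -- the closure of Ω.
  have e1 := eventually_mem_triangle hD (r := 1 / 2) (by norm_num) (by norm_num)
  have e2 := eventually_mem_triangle hD' (r := 1 / 2) (by norm_num) (by norm_num)
  have hm : a + (1 / 2 : ℝ) • (b - a) ∈ interior (closure Ω) := by
    rw [mem_interior_iff_mem_nhds]
    filter_upwards [e1, e2] with x h1 h2
    rcases le_total 0 (cross (b - a) (x - a) / cross (b - a) (c - a)) with hx | hx
    · exact T.region_subset_closure (by rw [Mesh.Tri.region_eq hT]; exact h1 hx)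
    · refine T'.region_subset_closure ((Mesh.Tri.region_eq hT').ge (h2 ?_))
      rcases mul_neg_iff.1 h with ⟨p, q⟩ | ⟨p, q⟩
      · rw [div_nonpos_iff] at hx
        rcases hx with ⟨_, hx⟩ | ⟨hx, _⟩
        · linarith
        · exact div_nonneg_of_nonpos hx q.le
      · rw [div_nonpos_iff] at hx
        rcases hx with ⟨hx, _⟩ | ⟨_, hx⟩
        · exact div_nonneg hx q.le
        · linarith
  intro hb
  have hmem : a + (1 / 2 : ℝ) • (b - a) ∈ e.region := by
    rw [Mesh.Edge.region_eq he, segment_eq_image']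
    exact ⟨1 / 2, by norm_num, rfl⟩
  have hf := hb hmem
  rw [hΩ, ← show interior Ω = Ω by rw [← hΩ, interior_interior]] at hm
  exact hf.2 hm

/-- An interior edge has a triangle on its other side. -/
theorem Mesh.Edge.exists_opposite (hΩ : IsOpen Ω) {e : M.Edge} (hb : ¬ e.IsBoundary)
    {a b c : Plane} (hab : a ≠ b) (he : e.1 = {a, b}) (hD : cross (b - a) (c - a) ≠ 0) :
    ∃ (T' : M.Tri) (c' : Plane), e.1 ⊆ T'.1 ∧ T'.1 = {a, b, c'} ∧
      cross (b - a) (c - a) * cross (b - a) (c' - a) < 0 := by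
  obtain ⟨x, hxe, hxf⟩ := not_subset.1 hb
  have hxΩ : x ∈ Ω := by
    obtain ⟨T, hT⟩ := e.adj_nonempty
    have := T.region_subset_closure (Mesh.Edge.region_subset (Mesh.Edge.mem_adj.1 hT) hxe)
    by_contra hn
    exact hxf ⟨this, by rwa [hΩ.interior_eq]⟩
  rw [Mesh.Edge.region_eq he, segment_eq_image'] at hxe
  obtain ⟨s, hs, rfl⟩ := hxe
  -- The point of the edge in Ω might be an endpoint; openness of Ω lets it move into the relative
  -- interior.
  obtain ⟨r, hrΩ, hr0, hr1⟩ : ∃ r : ℝ, a + r • (b - a) ∈ Ω ∧ 0 < r ∧ r < 1 := by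
    have hs' : s ∈ closure (Ioo (0 : ℝ) 1) := by rwa [closure_Ioo (by norm_num)]
    have hc : Continuous fun r : ℝ => a + r • (b - a) := by fun_prop
    obtain ⟨r, h1, h2⟩ := mem_closure_iff.1 hs' _ (hΩ.preimage hc) hxΩ
    exact ⟨r, h1, h2⟩
  set y := a + r • (b - a) with hy
  have hlim : Tendsto (fun t : ℝ => y - t • (c - a)) (𝓝[>] 0) (𝓝 y) := by
    have hc : Continuous fun t : ℝ => y - t • (c - a) := by fun_prop
    have := hc.tendsto 0
    simp only [zero_smul, sub_zero] at this
    exact this.mono_left nhdsWithin_le_nhds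
  have hex : ∀ᶠ t in 𝓝[>] (0 : ℝ), ∃ T' : M.Tri, y - t • (c - a) ∈ T'.region := by
    filter_upwards [hlim.eventually (hΩ.mem_nhds hrΩ)] with t ht
    have hsp : y - t • (c - a) ∈ M.K.space := by rw [M.space_eq]; exact subset_closure ht
    obtain ⟨s, hs, hys⟩ := Geometry.SimplicialComplex.mem_space_iff.1 hsp
    obtain ⟨t', ht', hst, hcard⟩ := M.pure s hs
    exact ⟨⟨t', ht', hcard⟩, convexHull_mono (by exact_mod_cast hst) hys⟩
  -- Pigeonhole: points approaching y from the side away from c are covered by finitely many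
  -- triangles, so one contains such points arbitrarily near y and, being closed, y itself.
  obtain ⟨T', hT'⟩ : ∃ T' : M.Tri, ∃ᶠ t in 𝓝[>] (0 : ℝ), y - t • (c - a) ∈ T'.region := by
    by_contra! hn
    obtain ⟨t, ⟨T', h1⟩, h2⟩ := (hex.and (eventually_all.2 hn)).exists
    exact h2 T' h1
  have hcl : IsClosed T'.region := (T'.1.finite_toSet).isClosed_convexHull ℝ
  have hyT : y ∈ T'.region := by
    by_contra hn
    have := hlim.eventually (hcl.isOpen_compl.mem_nhds hn)
    exact hT' (this.mono fun t ht => ht)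
  have hye : y ∈ e.region := by
    rw [Mesh.Edge.region_eq he, segment_eq_image']
    exact ⟨r, ⟨hr0.le, hr1.le⟩, rfl⟩
  -- By conformity y lies in the hull of the vertices shared by e and T'. As y is neither endpoint,
  -- both endpoints are shared.
  have hyi := M.K.inter_subset_convexHull e.2.1 T'.2.1 ⟨hye, hyT⟩
  have hba : b - a ≠ 0 := sub_ne_zero.2 hab.symm
  have heT : e.1 ⊆ T'.1 := by
    rw [he] at hyi ⊢
    intro z hz
    by_contra hzT
    have hzab : z = a ∨ z = b := by simpa using hz
    rcases hzab with rfl | rfl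
    · have hsub : ((({z, b} : Finset Plane) : Set Plane) ∩ T'.1) ⊆ {b} := by
        rintro w ⟨hw, hw'⟩
        have : w = z ∨ w = b := by simpa using hw
        rcases this with rfl | rfl
        · exact absurd hw' hzT
        · rfl
      have := convexHull_mono hsub hyi
      rw [convexHull_singleton, mem_singleton_iff, hy] at this
      have h2 : (1 - r) • (b - z) = 0 := by
        rw [sub_smul, one_smul, sub_eq_zero, sub_eq_iff_eq_add, add_comm, this]
      rcases smul_eq_zero.1 h2 with h | h
      · linarith
      · exact hba h
    · have hsub : ((({a, z} : Finset Plane) : Set Plane) ∩ T'.1) ⊆ {a} := by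
        rintro w ⟨hw, hw'⟩
        have : w = a ∨ w = z := by simpa using hw
        rcases this with rfl | rfl
        · rfl
        · exact absurd hw' hzT
      have := convexHull_mono hsub hyi
      rw [convexHull_singleton, mem_singleton_iff, hy, add_eq_left] at this
      rcases smul_eq_zero.1 this with h | h
      · linarith
      · exact hba h
  obtain ⟨c', hTc', -, -, hD'⟩ := Mesh.Edge.exists_third_vertex hab he heT
  refine ⟨T', c', heT, hTc', ?_⟩
  obtain ⟨t, htT, ht⟩ := (hT'.and_eventually self_mem_nhdsWithin).exists
  replace ht : 0 < t := ht
  rw [Mesh.Tri.region_eq hTc', mem_triangle_iff hD'] at htT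
  -- A point of T' lies strictly on the side opposite to c, hence so does c'.
  have hcr : cross (b - a) (y - t • (c - a) - a) = -(t * cross (b - a) (c - a)) := by
    rw [hy]; simp [cross]; ring
  have h2 := htT.2.1
  rw [hcr] at h2
  refine lt_of_le_of_ne ?_ (mul_ne_zero hD hD')
  have h3 := mul_nonneg h2 (sq_nonneg (cross (b - a) (c' - a)))
  have h4 : -(t * cross (b - a) (c - a)) / cross (b - a) (c' - a) * cross (b - a) (c' - a) ^ 2
      = -(t * (cross (b - a) (c - a) * cross (b - a) (c' - a))) := by
    field_simp
  rw [h4] at h3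
  by_contra! hn
  nlinarith [mul_pos ht hn]

/-- A second triangle would lie either on the same side, hence coincide with the first, or on the
opposite side, making the edge interior. -/
theorem Mesh.Edge.adj_eq_singleton (hΩ : interior (closure Ω) = Ω) {e : M.Edge}
    (hb : e.IsBoundary) : e.adj = {e.triPlus} := by
  obtain ⟨a, b, hab, he⟩ := e.exists_vertices
  obtain ⟨c, hT, hca, hcb, hD⟩ := Mesh.Edge.exists_third_vertex hab he e.triPlus_mem
  ext T'
  rw [Mesh.Edge.mem_adj, Finset.mem_singleton]
  constructor
  · intro h
    obtain ⟨c', hT', -, -, hD'⟩ := Mesh.Edge.exists_third_vertex hab he h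
    rcases lt_or_gt_of_ne (mul_ne_zero hD hD') with hlt | hgt
    · exact absurd hb (Mesh.Edge.not_isBoundary_of_opposite hΩ he hT hT' hlt)
    · exact (Mesh.Tri.eq_of_same_side hT hT' hca hcb hgt).symm
  · rintro rfl
    exact e.triPlus_mem

/-- Each side of the edge carries exactly one triangle. Existence on the far side is
`Mesh.Edge.exists_opposite`; uniqueness on each side is `Mesh.Tri.eq_of_same_side`. -/
theorem Mesh.Edge.interior_structure (hΩ : IsOpen Ω) {e : M.Edge} (hb : ¬ e.IsBoundary) :
    e.triPlus ≠ e.triMinus ∧ (∀ T, T ∈ e.adj ↔ T = e.triPlus ∨ T = e.triMinus) ∧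
      IsOuterNormal e.triMinus e (-e.normal) := by
  obtain ⟨a, b, hab, he⟩ := e.exists_vertices
  obtain ⟨c, hT, hca, hcb, hD⟩ := Mesh.Edge.exists_third_vertex hab he e.triPlus_mem
  obtain ⟨T', c', heT', hT', hop⟩ := Mesh.Edge.exists_opposite hΩ hb hab he hD
  have hD' : cross (b - a) (c' - a) ≠ 0 := by rintro h0; simp [h0] at hop
  have hc'a : c' ≠ a := by rintro rfl; simp [cross] at hD'
  have hc'b : c' ≠ b := by rintro rfl; exact hD' (by simp [cross]; ring)
  have hne : e.triPlus ≠ T' := by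
    intro h
    have hc' : c' ∈ ({a, b, c} : Finset Plane) := by
      rw [← hT, h, hT']; simp
    have : c' = c := by simpa [hc'a, hc'b] using hc'
    subst this
    nlinarith [mul_self_nonneg (cross (b - a) (c' - a))]
  have hadj : ∀ T, T ∈ e.adj ↔ T = e.triPlus ∨ T = T' := by
    intro T
    rw [Mesh.Edge.mem_adj]
    constructor
    · intro h
      obtain ⟨c₂, hT₂, -, -, hD₂⟩ := Mesh.Edge.exists_third_vertex hab he h
      rcases lt_or_gt_of_ne (mul_ne_zero hD hD₂) with hlt | hgt
      · right
        refine (Mesh.Tri.eq_of_same_side hT' hT₂ hc'a hc'b ?_).symm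
        have h1 := mul_pos_of_neg_of_neg hop hlt
        have h2 : cross (b - a) (c - a) * cross (b - a) (c' - a)
            * (cross (b - a) (c - a) * cross (b - a) (c₂ - a))
            = cross (b - a) (c - a) ^ 2 * (cross (b - a) (c' - a) * cross (b - a) (c₂ - a)) := by
          ring
        rw [h2] at h1
        exact pos_of_mul_pos_right h1 (sq_nonneg _)
      · exact Or.inl (Mesh.Tri.eq_of_same_side hT hT₂ hca hcb hgt).symm
    · rintro (rfl | rfl)
      · exact e.triPlus_mem
      · exact heT'
  have hminus : e.triMinus = T' := by
    rcases (hadj _).1 (Mesh.Edge.mem_adj.2 e.triMinus_mem) with h | h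
    -- If the largest and smallest numbered triangles coincided, T' would have the same number,
    -- against injectivity of the numbering.
    · exfalso
      have h1 := (Finset.exists_max_image e.adj (fun T => M.number T.1)
        e.adj_nonempty).choose_spec.2 T' (Mesh.Edge.mem_adj.2 heT')
      have h2 := (Finset.exists_min_image e.adj (fun T => M.number T.1)
        e.adj_nonempty).choose_spec.2 T' (Mesh.Edge.mem_adj.2 heT')
      change M.number T'.1 ≤ M.number e.triPlus.1 at h1
      change M.number e.triMinus.1 ≤ M.number T'.1 at h2
      rw [h] at h2
      exact hne (Subtype.ext (M.number_injOn e.triPlus.2 T'.2 (le_antisymm h2 h1)))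
    · exact h
  refine ⟨hminus ▸ hne, hminus ▸ hadj, ?_⟩
  rw [hminus, isOuterNormal_iff he hT' hD',
    (isOuterNormal_iff he hT hD).1 e.isOuterNormal_normal, outNormal_eq_neg hop]

open Classical in
/-- The Gauss–Green formula summed over the triangles of a mesh. -/
theorem Mesh.sum_integral_lineDeriv (hΩ : IsOpen Ω) (hΩ' : interior (closure Ω) = Ω)
    {F : Broken M} (hF : ∀ T, ∃ K, LipschitzWith K (F T)) (i : Fin 2) :
    ∑ T : M.Tri, ∫ x in T.region, lineDeriv ℝ (F T) x (coordVec i) =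
      ∑ e : M.Edge, (if e.IsBoundary then
          ∫ x in e.region, F e.triPlus x ∂(Measure.hausdorffMeasure 1)
        else (∫ x in e.region, F e.triPlus x ∂(Measure.hausdorffMeasure 1))
          - ∫ x in e.region, F e.triMinus x ∂(Measure.hausdorffMeasure 1)) * e.normal i := by
  have h1 : ∀ T : M.Tri, ∫ x in T.region, lineDeriv ℝ (F T) x (coordVec i) =
      ∑ e : M.Edge with e.1 ⊆ T.1, (∫ x in e.region, F T x ∂(Measure.hausdorffMeasure 1))
        * (if e.triPlus = T then e.normal else -e.normal) i := by
    intro T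
    obtain ⟨K, hK⟩ := hF T
    refine T.integral_lineDeriv hK i fun e he => ?_
    split_ifs with h
    · exact h ▸ e.isOuterNormal_normal
    · by_cases hb : e.IsBoundary
      · have := Mesh.Edge.mem_adj.2 he
        rw [Mesh.Edge.adj_eq_singleton hΩ' hb, Finset.mem_singleton] at this
        exact absurd this.symm h
      · obtain ⟨-, h2, h3⟩ := Mesh.Edge.interior_structure hΩ hb
        rcases (h2 T).1 (Mesh.Edge.mem_adj.2 he) with h4 | h4
        · exact absurd h4.symm h
        · exact h4 ▸ h3
  -- Exchanging the sums collects, at each edge, the contributions of its one or two adjacent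
  -- triangles.
  rw [Finset.sum_congr rfl fun T _ => h1 T, Finset.sum_comm' (t' := Finset.univ)
    (s' := fun e => e.adj) (by intro T e; simp [Mesh.Edge.mem_adj])]
  refine Finset.sum_congr rfl fun e _ => ?_
  split_ifs with hb
  · rw [Mesh.Edge.adj_eq_singleton hΩ' hb, Finset.sum_singleton, if_pos rfl]
  · obtain ⟨h1, h2, -⟩ := Mesh.Edge.interior_structure hΩ hb
    have : e.adj = {e.triPlus, e.triMinus} := by
      ext T; rw [h2]; simp
    rw [this, Finset.sum_pair h1, if_pos rfl, if_neg h1, PiLp.neg_apply]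
    ring

/-! ### Convex polygonal domains -/

theorem IsConvexPolygonalDomain.isOpen {Ω : Set Plane} (h : IsConvexPolygonalDomain Ω) :
    IsOpen Ω := by
  obtain ⟨-, s, rfl⟩ := h
  exact isOpen_interior

theorem IsConvexPolygonalDomain.convex {Ω : Set Plane} (h : IsConvexPolygonalDomain Ω) :
    Convex ℝ Ω := by
  obtain ⟨-, s, rfl⟩ := h
  exact (convex_convexHull ℝ _).interior

theorem IsConvexPolygonalDomain.interior_closure {Ω : Set Plane} (h : IsConvexPolygonalDomain Ω) :
    interior (closure Ω) = Ω := by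
  rw [h.convex.interior_closure_eq_interior_of_nonempty_interior, h.isOpen.interior_eq]
  rw [h.isOpen.interior_eq]
  exact h.1

/-! ### Lipschitz functions on triangles -/

/-- On a bounded set, a product of Lipschitz functions is the restriction of a Lipschitz
function. -/
theorem _root_.LipschitzWith.exists_lipschitz_eqOn_mul {X : Type*} [PseudoMetricSpace X]
    {S : Set X} (hS : IsCompact S) {F G : X → ℝ} {K L : NNReal} (hF : LipschitzWith K F)
    (hG : LipschitzWith L G) :
    ∃ (N : NNReal) (H : X → ℝ), LipschitzWith N H ∧ EqOn (fun x => F x * G x) H S := by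
  obtain ⟨A, hA⟩ := hS.exists_bound_of_continuousOn hF.continuous.continuousOn
  obtain ⟨B, hB⟩ := hS.exists_bound_of_continuousOn hG.continuous.continuousOn
  have hlip : LipschitzOnWith (A.toNNReal * L + B.toNNReal * K) (fun x => F x * G x) S := by
    refine LipschitzOnWith.of_dist_le_mul fun x hx y hy => ?_
    have h1 := hF.dist_le_mul x y
    have h2 := hG.dist_le_mul x y
    rw [Real.dist_eq] at h1 h2 ⊢
    have hA' : |F x| ≤ A.toNNReal := (hA x hx).trans (Real.le_coe_toNNReal A)
    have hB' : |G y| ≤ B.toNNReal := (hB y hy).trans (Real.le_coe_toNNReal B)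
    calc |F x * G x - F y * G y| = |F x * (G x - G y) + G y * (F x - F y)| := by ring_nf
      _ ≤ |F x| * |G x - G y| + |G y| * |F x - F y| := by
          rw [← abs_mul, ← abs_mul]; exact abs_add_le _ _
      _ ≤ A.toNNReal * (L * dist x y) + B.toNNReal * (K * dist x y) := by gcongr
      _ = ↑(A.toNNReal * L + B.toNNReal * K) * dist x y := by push_cast; ring
  obtain ⟨H, h1, h2⟩ := hlip.extend_real
  exact ⟨_, H, h1, h2⟩

theorem _root_.AffineMap.exists_lipschitzWith (p : Plane →ᵃ[ℝ] ℝ) : ∃ K, LipschitzWith K p := by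
  refine ⟨‖p.linear.toContinuousLinearMap‖₊, LipschitzWith.of_dist_le_mul fun x y => ?_⟩
  rw [dist_eq_norm, dist_eq_norm, ← vsub_eq_sub, ← AffineMap.linearMap_vsub, vsub_eq_sub]
  exact p.linear.toContinuousLinearMap.le_opNorm (x - y)

theorem _root_.AffineMap.hasFDerivAt_plane (p : Plane →ᵃ[ℝ] ℝ) (x : Plane) :
    HasFDerivAt p p.linear.toContinuousLinearMap x :=
  ContinuousAffineMap.hasFDerivAt
    (f := (⟨p, p.continuous_of_finiteDimensional⟩ : Plane →ᴬ[ℝ] ℝ))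

theorem Mesh.Tri.isCompact_region (T : M.Tri) : IsCompact T.region :=
  (T.1.finite_toSet).isCompact_convexHull ℝ

theorem Mesh.Tri.interior_ae_eq (T : M.Tri) : interior T.region =ᵐ[volume] T.region :=
  interior_ae_eq_of_null_frontier ((convex_convexHull ℝ _).addHaar_frontier volume)

theorem Mesh.Tri.restrict_interior (T : M.Tri) :
    volume.restrict (interior T.region) = volume.restrict T.region :=
  Measure.restrict_congr_set T.interior_ae_eq

theorem Mesh.Tri.interior_subset (T : M.Tri) (hΩ : interior (closure Ω) = Ω) :
    interior T.region ⊆ Ω :=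
  (interior_mono T.region_subset_closure).trans hΩ.le

/-- A closed triangle may touch ∂Ω, but its frontier is null and its interior lies in Ω. -/
theorem Mesh.Tri.ae_of_ae (T : M.Tri) (hΩ : interior (closure Ω) = Ω) {p : Plane → Prop}
    (h : ∀ᵐ x ∂(volume.restrict Ω), p x) : ∀ᵐ x ∂(volume.restrict T.region), p x := by
  rw [← T.restrict_interior]
  exact ae_restrict_of_ae_restrict_of_subset (T.interior_subset hΩ) h

theorem Mesh.Tri.interior_nonempty (T : M.Tri) : (interior T.region).Nonempty := by
  rw [Mesh.Tri.region, interior_convexHull_nonempty_iff_affineSpan_eq_top]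
  have h := (M.K.indep T.2.1).affineSpan_eq_top_iff_card_eq_finrank_add_one
  have h2 : Set.range ((↑) : T.1 → Plane) = (T.1 : Set Plane) := Subtype.range_coe
  rw [h2] at h
  rw [h]
  simp [T.2.2]

/-- Gauss–Green asks for a globally Lipschitz integrand, so F p q is replaced by a Lipschitz
extension H from the triangle. Near interior points H is the product, and the product rule holds
wherever F is differentiable. -/
theorem Mesh.Tri.integral_lineDeriv_mul_mul (T : M.Tri) {K : NNReal} {F : Plane → ℝ}
    (hF : LipschitzWith K F) (p q : Plane →ᵃ[ℝ] ℝ) :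
    ∃ (L : NNReal) (H : Plane → ℝ), LipschitzWith L H ∧
      (∀ x ∈ T.region, H x = F x * p x * q x) ∧ ∀ i,
      ∫ x in T.region, lineDeriv ℝ H x (coordVec i) = ∫ x in T.region,
        ((lineDeriv ℝ F x (coordVec i) * p x + F x * p.linear (coordVec i)) * q x
          + F x * p x * q.linear (coordVec i)) := by
  obtain ⟨Kp, hp⟩ := p.exists_lipschitzWith
  obtain ⟨Kq, hq⟩ := q.exists_lipschitzWith
  obtain ⟨N, G, hG, hGe⟩ := hF.exists_lipschitz_eqOn_mul T.isCompact_region hp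
  obtain ⟨L, H, hH, hHe⟩ := hG.exists_lipschitz_eqOn_mul T.isCompact_region hq
  have hHx : ∀ x ∈ T.region, H x = F x * p x * q x := by
    intro x hx
    rw [← hHe hx]
    simp only
    rw [← hGe hx]
  refine ⟨L, H, hH, hHx, fun i => ?_⟩
  rw [← T.restrict_interior]
  refine integral_congr_ae ?_
  rw [EventuallyEq, ae_restrict_iff' isOpen_interior.measurableSet]
  filter_upwards [hF.ae_differentiableAt (μ := volume)] with x hx hxT
  have he : H =ᶠ[𝓝 x] fun x => F x * p x * q x := by
    filter_upwards [isOpen_interior.mem_nhds hxT] with y hy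
    exact hHx y (_root_.interior_subset hy)
  rw [he.lineDeriv_eq]
  have h1 := (hx.hasFDerivAt.mul (p.hasFDerivAt_plane x)).mul (q.hasFDerivAt_plane x)
  have h2 := (h1.hasLineDerivAt (coordVec i)).lineDeriv
  rw [show (fun x => F x * p x * q x) = F * ⇑p * ⇑q from rfl, h2, hx.lineDeriv_eq_fderiv]
  simp
  ring

/-! ### Integrability -/

theorem _root_.AffineMap.continuous_plane (p : Plane →ᵃ[ℝ] ℝ) : Continuous p :=
  p.continuous_of_finiteDimensional

theorem Mesh.Edge.integrableOn (e : M.Edge) {f : Plane → ℝ} (hf : ContinuousOn f e.region) :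
    IntegrableOn f e.region (Measure.hausdorffMeasure 1) := by
  obtain ⟨a, b, -, he⟩ := e.exists_vertices
  have hc : IsCompact e.region := (e.1.finite_toSet).isCompact_convexHull ℝ
  obtain ⟨C, hC⟩ := hc.exists_bound_of_continuousOn hf
  have : IsFiniteMeasure ((Measure.hausdorffMeasure 1).restrict e.region) := ⟨by
    rw [Measure.restrict_apply_univ, Mesh.Edge.region_eq he, hausdorffMeasure_segment]
    exact edist_lt_top _ _⟩
  refine Integrable.of_bound (hf.aestronglyMeasurable hc.measurableSet) C ?_
  rw [ae_restrict_iff' hc.measurableSet]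
  exact .of_forall hC

theorem Mesh.Tri.integrableOn (T : M.Tri) {f : Plane → ℝ} (hf : ContinuousOn f T.region) :
    IntegrableOn f T.region :=
  hf.integrableOn_compact T.isCompact_region

/-- Multiplication with a weight that is bounded and measurable on the domain preserves
integrability of continuous functions on a triangle. -/
theorem Mesh.Tri.integrableOn_mul (T : M.Tri) (hΩ : interior (closure Ω) = Ω) {g f : Plane → ℝ}
    (hg : MemLp g ⊤ (volume.restrict Ω)) (hf : ContinuousOn f T.region) :
    IntegrableOn (fun x => g x * f x) T.region := by
  have hm : volume.restrict T.region ≤ volume.restrict Ω := by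
    rw [← T.restrict_interior]
    exact Measure.restrict_mono (T.interior_subset hΩ) le_rfl
  have hg' := hg.mono_measure hm
  exact (T.integrableOn hf).bdd_mul hg'.aestronglyMeasurable (ae_le_lpNorm_exponent_top hg')

/-! ### Functions in `W^{1,∞}` -/

theorem MemW1Inf.continuousOn_contRep (hΩ : IsConvexPolygonalDomain Ω) {z : Plane → ℝ}
    (hz : MemW1Inf Ω z) : ContinuousOn (contRep Ω z) (closure Ω) := by
  obtain ⟨K, F, hF, hFz⟩ := hz.exists_lipschitz hΩ.isOpen hΩ.convex
  exact hF.continuous.continuousOn.congr (contRep_eqOn hΩ.isOpen hF.continuous hFz)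

theorem weakPartial_ae_eq_lineDeriv {U : Set Plane} (hU : IsOpen U) {z F : Plane → ℝ}
    {K : NNReal} (hF : LipschitzWith K F) (hz : z =ᵐ[volume.restrict U] F) (i : Fin 2) :
    weakPartial U i z =ᵐ[volume.restrict U] fun x => lineDeriv ℝ F x (coordVec i) := by
  have h := hF.isWeakPartial_mul_affine U i (AffineMap.const ℝ Plane (1 : ℝ))
  simp only [AffineMap.const_apply, mul_one, AffineMap.const_linear, LinearMap.zero_apply,
    mul_zero, add_zero] at h
  exact (h.congr hz.symm).weakPartial_ae_eq hU

theorem MemW1Inf.memLp_weakPartial (hΩ : IsConvexPolygonalDomain Ω) {z : Plane → ℝ}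
    (hz : MemW1Inf Ω z) (i : Fin 2) : MemLp (weakPartial Ω i z) ⊤ (volume.restrict Ω) := by
  obtain ⟨g, hg, hgw⟩ := hz.2 i
  exact (memLp_congr_ae (hgw.weakPartial_ae_eq hΩ.isOpen)).2 hg

theorem MemW1Inf.continuousOn_mulDG (hΩ : IsConvexPolygonalDomain Ω) {z : Plane → ℝ}
    (hz : MemW1Inf Ω z) (v : DGSpace M) (T : M.Tri) : ContinuousOn (mulDG z v T) T.region :=
  ((hz.continuousOn_contRep hΩ).mono T.region_subset_closure).mul
    (v T).continuous_plane.continuousOn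

/-- Product rule relating the weak derivative taken on one triangle to the one on Ω: both are
computed from the same Lipschitz F. -/
theorem MemW1Inf.weakPartial_mulDG (hΩ : IsConvexPolygonalDomain Ω) {z : Plane → ℝ}
    (hz : MemW1Inf Ω z) (v : DGSpace M) (T : M.Tri) (i : Fin 2) :
    ∀ᵐ x ∂(volume.restrict T.region), weakPartial (interior T.region) i (mulDG z v T) x
      = weakPartial Ω i z x * v T x + contRep Ω z x * (v T).linear (coordVec i) := by
  obtain ⟨K, F, hF, hFz⟩ := hz.exists_lipschitz hΩ.isOpen hΩ.convex
  have hrep := contRep_eqOn hΩ.isOpen hF.continuous hFz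
  have h1 := T.ae_of_ae hΩ.interior_closure (weakPartial_ae_eq_lineDeriv hΩ.isOpen hF hFz i)
  have h2 := hF.isWeakPartial_mul_affine (interior T.region) i (v T)
  have h3 : (fun x => F x * v T x) =ᵐ[volume.restrict (interior T.region)] mulDG z v T := by
    rw [EventuallyEq, ae_restrict_iff' isOpen_interior.measurableSet]
    refine .of_forall fun x hx => ?_
    simp only [mulDG]
    rw [hrep (subset_closure (T.interior_subset hΩ.interior_closure hx))]
  have h4 := (h2.congr h3).weakPartial_ae_eq isOpen_interior
  rw [T.restrict_interior] at h4
  filter_upwards [h1, h4, ae_restrict_mem T.isCompact_region.measurableSet] with x hx1 hx4 hxT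
  rw [hx4, hx1, hrep (T.region_subset_closure hxT)]

/-- The Gauss–Green formula for the product of a `W^{1,∞}` function and two DG functions. -/
theorem MemW1Inf.gaussGreen (hΩ : IsConvexPolygonalDomain Ω) {z : Plane → ℝ}
    (hz : MemW1Inf Ω z) (v φ : DGSpace M) (i : Fin 2) :
    ip (fun T x => weakPartial Ω i z x * v T x) (toBroken φ) + ip (mulDG z φ) (partialDG i v)
        + ip (mulDG z v) (partialDG i φ)
      = edgeIp Finset.univ
          (fun e x => contRep Ω z x * jump (fun T x => v T x * φ T x) e x)
          (fun (e : M.Edge) _ => e.normal i) := by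
  classical
  obtain ⟨K, F, hF, hFz⟩ := hz.exists_lipschitz hΩ.isOpen hΩ.convex
  have hrep := contRep_eqOn hΩ.isOpen hF.continuous hFz
  have hzc := hz.continuousOn_contRep hΩ
  -- Each triangle gets its own extension. It equals the product on the closed triangle, so the edge
  -- integrals see the correct one-sided traces.
  choose L H hH hHT hHi using fun T : M.Tri => T.integral_lineDeriv_mul_mul hF (v T) (φ T)
  have hlhs : ip (fun T x => weakPartial Ω i z x * v T x) (toBroken φ)
      + ip (mulDG z φ) (partialDG i v) + ip (mulDG z v) (partialDG i φ)
      = ∑ T : M.Tri, ∫ x in T.region, lineDeriv ℝ (H T) x (coordVec i) := by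
    simp only [ip]
    rw [← Finset.sum_add_distrib, ← Finset.sum_add_distrib]
    refine Finset.sum_congr rfl fun T _ => ?_
    rw [hHi T i]
    have i1 : IntegrableOn (fun x => weakPartial Ω i z x * v T x * toBroken φ T x) T.region := by
      simp_rw [mul_assoc]
      exact T.integrableOn_mul hΩ.interior_closure (hz.memLp_weakPartial hΩ i)
        ((v T).continuous_plane.mul (φ T).continuous_plane).continuousOn
    have i2 : ∀ w u : DGSpace M,
        IntegrableOn (fun x => mulDG z w T x * partialDG i u T x) T.region := fun w u =>
      T.integrableOn ((hz.continuousOn_mulDG hΩ w T).mul continuousOn_const)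
    rw [← integral_add i1 (i2 φ v)]
    refine (integral_add (i1.add (i2 φ v)) (i2 v φ)).symm.trans (integral_congr_ae ?_)
    filter_upwards [T.ae_of_ae hΩ.interior_closure (weakPartial_ae_eq_lineDeriv hΩ.isOpen hF hFz i),
      ae_restrict_mem T.isCompact_region.measurableSet] with x hx hxT
    rw [← hx]
    simp only [mulDG, toBroken, partialDG, Pi.add_apply]
    rw [hrep (T.region_subset_closure hxT)]
    ring
  rw [hlhs, Mesh.sum_integral_lineDeriv hΩ.isOpen hΩ.interior_closure (fun T => ⟨L T, hH T⟩) i,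
    edgeIp]
  refine Finset.sum_congr rfl fun e _ => ?_
  rw [integral_mul_const]
  congr 1
  have hm : MeasurableSet e.region :=
    ((e.1.finite_toSet).isCompact_convexHull ℝ).measurableSet
  have hside : ∀ T : M.Tri, e.1 ⊆ T.1 →
      (∫ x in e.region, H T x ∂(Measure.hausdorffMeasure 1))
        = ∫ x in e.region, contRep Ω z x * (v T x * φ T x) ∂(Measure.hausdorffMeasure 1) := by
    intro T hT
    refine setIntegral_congr_fun hm fun x hx => ?_
    have hxT := Mesh.Edge.region_subset hT hx
    rw [hHT T x hxT, hrep (T.region_subset_closure hxT), mul_assoc]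
  have hint : ∀ T : M.Tri, e.1 ⊆ T.1 → IntegrableOn
      (fun x => contRep Ω z x * (v T x * φ T x)) e.region (Measure.hausdorffMeasure 1) := by
    intro T hT
    refine e.integrableOn ((hzc.mono ?_).mul
      ((v T).continuous_plane.mul (φ T).continuous_plane).continuousOn)
    exact (Mesh.Edge.region_subset hT).trans T.region_subset_closure
  rw [hside _ e.triPlus_mem, hside _ e.triMinus_mem]
  by_cases hb : e.IsBoundary
  · simp only [jump, hb, if_true]
  · simp only [jump, hb, if_false]
    rw [← integral_sub (hint _ e.triPlus_mem) (hint _ e.triMinus_mem)]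
    congr with x
    ring

/-! ### The discrete derivatives -/

theorem continuousOn_jump {v : Broken M} (hv : ∀ T : M.Tri, ContinuousOn (v T) T.region)
    (e : M.Edge) : ContinuousOn (jump v e) e.region := by
  have h1 := (hv e.triPlus).mono (Mesh.Edge.region_subset e.triPlus_mem)
  have h2 := (hv e.triMinus).mono (Mesh.Edge.region_subset e.triMinus_mem)
  by_cases hb : e.IsBoundary
  · exact h1.congr fun x _ => by simp [jump, hb]
  · exact (h1.sub h2).congr fun x _ => by simp [jump, hb]

theorem continuousOn_avg {v : Broken M} (hv : ∀ T : M.Tri, ContinuousOn (v T) T.region)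
    (e : M.Edge) : ContinuousOn (avg v e) e.region := by
  have h1 := (hv e.triPlus).mono (Mesh.Edge.region_subset e.triPlus_mem)
  have h2 := (hv e.triMinus).mono (Mesh.Edge.region_subset e.triMinus_mem)
  by_cases hb : e.IsBoundary
  · exact h1.congr fun x _ => by simp [avg, hb]
  · exact ((h1.add h2).div_const 2).congr fun x _ => by simp [avg, hb]

theorem continuousOn_traceQ {v : Broken M} (hv : ∀ T : M.Tri, ContinuousOn (v T) T.region)
    (s : Side) (i : Fin 2) (e : M.Edge) : ContinuousOn (traceQ s i v e) e.region := by
  have h1 := (hv e.triPlus).mono (Mesh.Edge.region_subset e.triPlus_mem)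
  have h2 := (hv e.triMinus).mono (Mesh.Edge.region_subset e.triMinus_mem)
  have h3 := continuousOn_avg hv e
  unfold traceQ
  split_ifs
  · exact h1
  · exact h3
  · cases s
    · exact h1
    · exact h2
  · cases s
    · exact h2
    · exact h1

theorem continuousOn_toBroken (v : DGSpace M) (T : M.Tri) :
    ContinuousOn (toBroken v T) T.region :=
  (v T).continuous_plane.continuousOn

theorem ip_add_left {u v w : Broken M} (hu : ∀ T : M.Tri, ContinuousOn (u T) T.region)
    (hv : ∀ T : M.Tri, ContinuousOn (v T) T.region)
    (hw : ∀ T : M.Tri, ContinuousOn (w T) T.region) :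
    ip (fun T x => u T x + v T x) w = ip u w + ip v w := by
  simp only [ip]
  rw [← Finset.sum_add_distrib]
  refine Finset.sum_congr rfl fun T _ => ?_
  refine Eq.trans ?_ (integral_add (T.integrableOn ((hu T).mul (hw T)))
    (T.integrableOn ((hv T).mul (hw T))))
  congr with x
  ring

theorem ip_comm (u v : Broken M) : ip u v = ip v u := by
  simp only [ip, mul_comm]

theorem ip_smul_left (c : ℝ) (u v : Broken M) : ip (fun T x => c * u T x) v = c * ip u v := by
  simp only [ip]
  rw [Finset.mul_sum]
  refine Finset.sum_congr rfl fun T _ => ?_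
  rw [← integral_const_mul]
  congr with x
  ring

theorem toBroken_add (u v : DGSpace M) :
    toBroken (u + v) = fun T x => toBroken u T x + toBroken v T x := rfl

theorem toBroken_smul (c : ℝ) (u : DGSpace M) :
    toBroken (c • u) = fun T x => c * toBroken u T x := rfl

/-- The `L₂` inner product on the DG space. -/
def ipForm (M : Mesh Ω) : DGSpace M →ₗ[ℝ] DGSpace M →ₗ[ℝ] ℝ :=
  LinearMap.mk₂ ℝ (fun u v => ip (toBroken u) (toBroken v))
    (fun u v w => by
      rw [toBroken_add, ip_add_left (continuousOn_toBroken u) (continuousOn_toBroken v)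
        (continuousOn_toBroken w)])
    (fun c u v => by rw [toBroken_smul, ip_smul_left, smul_eq_mul])
    (fun u v w => by
      rw [ip_comm, toBroken_add, ip_add_left (continuousOn_toBroken v) (continuousOn_toBroken w)
        (continuousOn_toBroken u), ip_comm (toBroken v), ip_comm (toBroken w)])
    (fun c u v => by rw [ip_comm, toBroken_smul, ip_smul_left, smul_eq_mul, ip_comm])

/-- Each piece vanishes a.e., hence everywhere, on the nonempty interior of its triangle. That
interior affinely spans the plane, so the affine map is zero. -/
theorem eq_zero_of_ip_self_eq_zero {w : DGSpace M} (h : ip (toBroken w) (toBroken w) = 0) :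
    w = 0 := by
  have h0 : ∀ T : M.Tri, 0 ≤ ∫ x in T.region, toBroken w T x * toBroken w T x := fun T =>
    integral_nonneg fun x => mul_self_nonneg _
  rw [ip, Finset.sum_eq_zero_iff_of_nonneg fun T _ => h0 T] at h
  funext T
  have hT := h T (Finset.mem_univ T)
  rw [integral_eq_zero_iff_of_nonneg (fun x => mul_self_nonneg _) (T.integrableOn
    ((continuousOn_toBroken w T).mul (continuousOn_toBroken w T))), ← T.restrict_interior] at hT
  have hE : EqOn (w T) (0 : Plane →ᵃ[ℝ] ℝ) (interior T.region) := by
    refine Measure.eqOn_open_of_ae_eq (μ := volume) ?_ isOpen_interior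
      (w T).continuous_plane.continuousOn continuousOn_const
    filter_upwards [hT] with x hx
    exact mul_self_eq_zero.1 hx
  exact AffineMap.ext_on (isOpen_interior.affineSpan_eq_top T.interior_nonempty) hE

theorem jump_add (u v : Broken M) (e : M.Edge) (x : Plane) :
    jump (fun T x => u T x + v T x) e x = jump u e x + jump v e x := by
  simp only [jump]; split_ifs <;> ring

theorem jump_smul (c : ℝ) (u : Broken M) (e : M.Edge) (x : Plane) :
    jump (fun T x => c * u T x) e x = c * jump u e x := by
  simp only [jump]; split_ifs <;> ring

/-- The functional that defines the discrete derivatives. -/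
def discretePartialFunctional (s : Side) (i : Fin 2) {v : Broken M}
    (hv : ∀ T : M.Tri, ContinuousOn (v T) T.region) : DGSpace M →ₗ[ℝ] ℝ where
  toFun := discretePartialRhs s i v
  map_add' φ ψ := by
    have h1 : ip v (partialDG i (φ + ψ)) = ip v (partialDG i φ) + ip v (partialDG i ψ) := by
      have := ip_add_left (u := partialDG i φ) (v := partialDG i ψ) (fun T => continuousOn_const)
        (fun T => continuousOn_const) hv
      rw [ip_comm v, ip_comm v, ip_comm v, ← this]
      rfl
    simp only [discretePartialRhs, h1, edgeIp, toBroken_add, jump_add, mul_add]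
    rw [Finset.sum_congr rfl fun e _ => integral_add
      (e.integrableOn (((continuousOn_traceQ hv s i e).mul continuousOn_const).mul
        (continuousOn_jump (continuousOn_toBroken φ) e)))
      (e.integrableOn (((continuousOn_traceQ hv s i e).mul continuousOn_const).mul
        (continuousOn_jump (continuousOn_toBroken ψ) e))), Finset.sum_add_distrib]
    ring
  map_smul' c φ := by
    have h1 : ip v (partialDG i (c • φ)) = c * ip v (partialDG i φ) := by
      rw [ip_comm v, ip_comm v, ← ip_smul_left]
      rfl
    simp only [discretePartialRhs, h1, edgeIp, toBroken_smul, jump_smul, RingHom.id_apply,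
      smul_eq_mul, mul_left_comm _ c, integral_const_mul, ← Finset.mul_sum, mul_sub]

/-- Riesz representation in finite dimension: the L₂ form gives an injective, hence surjective, map
to the dual, so the defining equation is solvable and the chosen element satisfies it. -/
theorem discretePartial_spec {v : Broken M} (hv : ∀ T : M.Tri, ContinuousOn (v T) T.region)
    (s : Side) (i : Fin 2) (φ : DGSpace M) :
    ip (toBroken (discretePartial s i v)) (toBroken φ) = discretePartialRhs s i v φ := by
  have hinj : Function.Injective (ipForm M) := by
    rw [injective_iff_map_eq_zero]
    intro w hw
    exact eq_zero_of_ip_self_eq_zero (LinearMap.congr_fun hw w)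
  have hsurj := (LinearMap.injective_iff_surjective_of_finrank_eq_finrank
    (Subspace.dual_finrank_eq (K := ℝ) (V := DGSpace M)).symm).1 hinj
  obtain ⟨w, hw⟩ := hsurj (discretePartialFunctional s i hv)
  have hex : ∃ w : DGSpace M, ∀ φ : DGSpace M,
      ip (toBroken w) (toBroken φ) = discretePartialRhs s i v φ :=
    ⟨w, fun φ => LinearMap.congr_fun hw φ⟩
  exact Classical.epsilon_spec hex φ

/-! ### Generalized integration by parts -/

theorem Mesh.Edge.integral_add_eq_add (e : M.Edge) {f g h k : Plane → ℝ}
    (hf : ContinuousOn f e.region) (hg : ContinuousOn g e.region) (hh : ContinuousOn h e.region)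
    (hk : ContinuousOn k e.region) (H : ∀ x, f x + g x = h x + k x) :
    (∫ x in e.region, f x ∂(Measure.hausdorffMeasure 1))
        + ∫ x in e.region, g x ∂(Measure.hausdorffMeasure 1)
      = (∫ x in e.region, h x ∂(Measure.hausdorffMeasure 1))
        + ∫ x in e.region, k x ∂(Measure.hausdorffMeasure 1) := by
  rw [← integral_add (e.integrableOn hf) (e.integrableOn hg),
    ← integral_add (e.integrableOn hh) (e.integrableOn hk)]
  simp_rw [H]

theorem MemW1Inf.continuousOn_contRep_edge (hΩ : IsConvexPolygonalDomain Ω) {z : Plane → ℝ}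
    (hz : MemW1Inf Ω z) (e : M.Edge) : ContinuousOn (contRep Ω z) e.region :=
  (hz.continuousOn_contRep hΩ).mono
    ((Mesh.Edge.region_subset e.triPlus_mem).trans e.triPlus.region_subset_closure)

theorem continuousOn_mul_toBroken (v w : DGSpace M) (T : M.Tri) :
    ContinuousOn (fun x => v T x * w T x) T.region :=
  ((v T).continuous_plane.mul (w T).continuous_plane).continuousOn

open Classical in
theorem edgeIp_bdryEdges (f g : M.Edge → Plane → ℝ) :
    edgeIp M.bdryEdges f g = ∑ e : M.Edge, if e.IsBoundary then
      ∫ x in e.region, f e x * g e x ∂(Measure.hausdorffMeasure 1) else 0 := by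
  rw [edgeIp, Mesh.bdryEdges, Finset.sum_filter]

open Classical in
theorem edgeIp_intEdges (f g : M.Edge → Plane → ℝ) :
    edgeIp M.intEdges f g = ∑ e : M.Edge, if e.IsBoundary then 0 else
      ∫ x in e.region, f e x * g e x ∂(Measure.hausdorffMeasure 1) := by
  rw [edgeIp, Mesh.intEdges, Finset.sum_filter]
  exact Finset.sum_congr rfl fun e _ => ite_not _ _ _

/-- Opposite traces telescope on interior edges, as in v⁺(φ⁺ - φ⁻) + φ⁻(v⁺ - v⁻) = v⁺φ⁺ - v⁻φ⁻. On a
boundary edge vφ is counted twice but [vφ] only once; the surplus is the boundary term. -/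
theorem MemW1Inf.edgeIp_traceQ_add (hΩ : IsConvexPolygonalDomain Ω) {z : Plane → ℝ}
    (hz : MemW1Inf Ω z) (s : Side) (i : Fin 2) (v φ : DGSpace M) :
    edgeIp Finset.univ (fun e x => traceQ s i (mulDG z v) e x * e.normal i) (jump (toBroken φ))
        + edgeIp Finset.univ (fun e x => traceQ s.flip i (mulDG z φ) e x * e.normal i)
            (jump (toBroken v))
      = edgeIp Finset.univ
          (fun e x => contRep Ω z x * jump (fun T x => v T x * φ T x) e x)
          (fun (e : M.Edge) _ => e.normal i)
        + edgeIp M.bdryEdges (fun e x => contRep Ω z x * φ e.triPlus x)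
            (fun e x => v e.triPlus x * e.normal i) := by
  classical
  rw [edgeIp_bdryEdges]
  simp only [edgeIp]
  rw [← Finset.sum_add_distrib, ← Finset.sum_add_distrib]
  refine Finset.sum_congr rfl fun e _ => ?_
  have hzc := hz.continuousOn_contRep_edge hΩ e
  have c1 : ∀ (s : Side) (v φ : DGSpace M), ContinuousOn
      (fun x => traceQ s i (mulDG z v) e x * e.normal i * jump (toBroken φ) e x) e.region :=
    fun s v φ => ((continuousOn_traceQ (hz.continuousOn_mulDG hΩ v) s i e).mul
      continuousOn_const).mul (continuousOn_jump (continuousOn_toBroken φ) e)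
  have c2 : ContinuousOn (fun x => contRep Ω z x * jump (fun T x => v T x * φ T x) e x
      * e.normal i) e.region :=
    (hzc.mul (continuousOn_jump (continuousOn_mul_toBroken v φ) e)).mul continuousOn_const
  have c3 : ContinuousOn (fun x => contRep Ω z x * φ e.triPlus x
      * (v e.triPlus x * e.normal i)) e.region :=
    (hzc.mul (φ _).continuous_plane.continuousOn).mul
      ((v _).continuous_plane.continuousOn.mul continuousOn_const)
  by_cases hb : e.IsBoundary
  · rw [if_pos hb]
    refine e.integral_add_eq_add (c1 _ _ _) (c1 _ _ _) c2 c3 fun x => ?_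
    simp only [traceQ, jump, hb, if_true, mulDG, toBroken]
    ring
  · rw [if_neg hb]
    have := e.integral_add_eq_add (c1 s v φ) (c1 s.flip φ v) c2 (continuousOn_const (c := 0)) ?_
    · rw [this, integral_zero]
    · intro x
      -- Here both traces are averages and the telescoping fails, but the factor n^(i) annihilates
      -- every term.
      by_cases h0 : e.normal i = 0
      · simp [h0]
      · cases s <;> by_cases h1 : 0 < e.normal i <;>
          simp only [traceQ, jump, hb, if_false, h0, h1, if_true, mulDG, toBroken, Side.flip] <;>
          ring

theorem MemW1Inf.integration_by_parts (hΩ : IsConvexPolygonalDomain Ω) {z : Plane → ℝ}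
    (hz : MemW1Inf Ω z) (s : Side) (i : Fin 2) (v φ : DGSpace M) :
    ip (toBroken (discretePartial s i (mulDG z v))) (toBroken φ) =
      -ip (toBroken (discretePartial s.flip i (mulDG z φ))) (toBroken v)
        + ip (toBroken φ) (fun T x => weakPartial Ω i z x * v T x)
        + edgeIp M.bdryEdges (fun e x => contRep Ω z x * φ e.triPlus x)
            (fun e x => v e.triPlus x * e.normal i) := by
  rw [discretePartial_spec (hz.continuousOn_mulDG hΩ v),
    discretePartial_spec (hz.continuousOn_mulDG hΩ φ), discretePartialRhs, discretePartialRhs]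
  have h1 := hz.gaussGreen hΩ v φ i
  have h2 := hz.edgeIp_traceQ_add hΩ s i v φ
  rw [ip_comm (toBroken φ)]
  linarith

/-! ### The centered-flux form of the average divergence -/

theorem ip_avgDiv (v : Fin 2 → Broken M) (w : DGSpace M) :
    ip (toBroken (avgDiv v)) (toBroken w) = ∑ i, (1 / 2 : ℝ) *
      (ip (toBroken (discretePartial .plus i (v i))) (toBroken w)
        + ip (toBroken (discretePartial .minus i (v i))) (toBroken w)) := by
  have : ∀ u : DGSpace M, ip (toBroken u) (toBroken w) = (ipForm M) u w := fun u => rfl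
  simp only [this, avgDiv, discreteDiv, map_smul, map_add, LinearMap.smul_apply,
    LinearMap.add_apply, smul_eq_mul, Fin.sum_univ_two]
  ring

/-- The two traces sum to 2{v} (up to the common factor z), and {v}[w] = [vw] - [v]{w} on interior
edges. On boundary edges vw = [vw], with nothing to subtract. -/
theorem MemW1Inf.edgeIp_traceQ_average (hΩ : IsConvexPolygonalDomain Ω) {z : Plane → ℝ}
    (hz : MemW1Inf Ω z) (i : Fin 2) (v w : DGSpace M) :
    edgeIp Finset.univ (fun e x => traceQ .plus i (mulDG z v) e x * e.normal i)
          (jump (toBroken w))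
        + edgeIp Finset.univ (fun e x => traceQ .minus i (mulDG z v) e x * e.normal i)
          (jump (toBroken w))
      = 2 * (edgeIp Finset.univ
          (fun e x => contRep Ω z x * jump (fun T x => v T x * w T x) e x)
          (fun (e : M.Edge) _ => e.normal i)
        - edgeIp M.intEdges (fun e x => contRep Ω z x * e.normal i * jump (toBroken v) e x)
          (avg (toBroken w))) := by
  classical
  rw [edgeIp_intEdges]
  simp only [edgeIp]
  rw [← Finset.sum_add_distrib, ← Finset.sum_sub_distrib, Finset.mul_sum]
  refine Finset.sum_congr rfl fun e _ => ?_
  have hzc := hz.continuousOn_contRep_edge hΩ e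
  have c1 : ∀ s : Side, ContinuousOn
      (fun x => traceQ s i (mulDG z v) e x * e.normal i * jump (toBroken w) e x) e.region :=
    fun s => ((continuousOn_traceQ (hz.continuousOn_mulDG hΩ v) s i e).mul
      continuousOn_const).mul (continuousOn_jump (continuousOn_toBroken w) e)
  have c2 : ContinuousOn (fun x => 2 * (contRep Ω z x * jump (fun T x => v T x * w T x) e x
      * e.normal i)) e.region :=
    continuousOn_const.mul
      ((hzc.mul (continuousOn_jump (continuousOn_mul_toBroken v w) e)).mul continuousOn_const)
  have c3 : ContinuousOn (fun x => -2 * (contRep Ω z x * e.normal i * jump (toBroken v) e x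
      * avg (toBroken w) e x)) e.region :=
    continuousOn_const.mul (((hzc.mul continuousOn_const).mul
      (continuousOn_jump (continuousOn_toBroken v) e)).mul
        (continuousOn_avg (continuousOn_toBroken w) e))
  by_cases hb : e.IsBoundary
  · rw [if_pos hb]
    have := e.integral_add_eq_add (c1 .plus) (c1 .minus) c2 (continuousOn_const (c := 0)) ?_
    · rw [this, integral_zero, integral_const_mul, add_zero, sub_zero]
    · intro x
      simp only [traceQ, jump, hb, if_true, mulDG, toBroken]
      ring
  · rw [if_neg hb]
    have := e.integral_add_eq_add (c1 .plus) (c1 .minus) c2 c3 ?_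
    · rw [this, integral_const_mul, integral_const_mul]
      ring
    · intro x
      by_cases h0 : e.normal i = 0
      · simp [h0]
      · by_cases h1 : 0 < e.normal i <;>
          simp only [traceQ, jump, avg, hb, if_false, h0, h1, if_true, mulDG, toBroken] <;>
          ring

theorem ip_brokenDiv (hΩ : IsConvexPolygonalDomain Ω) {ζ : Fin 2 → Plane → ℝ}
    (hζ : ∀ i, MemW1Inf Ω (ζ i)) (v w : DGSpace M) :
    ip (brokenDiv ζ v) (toBroken w) = ∑ i,
      (ip (fun T x => weakPartial Ω i (ζ i) x * v T x) (toBroken w)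
        + ip (mulDG (ζ i) w) (partialDG i v)) := by
  simp only [ip]
  simp_rw [← Finset.sum_add_distrib]
  rw [Finset.sum_comm]
  refine Finset.sum_congr rfl fun T _ => ?_
  have i1 : ∀ i, IntegrableOn (fun x => weakPartial Ω i (ζ i) x * v T x * toBroken w T x)
      T.region := fun i => by
    simp_rw [mul_assoc]
    exact T.integrableOn_mul hΩ.interior_closure ((hζ i).memLp_weakPartial hΩ i)
      (continuousOn_mul_toBroken v w T)
  have i2 : ∀ i, IntegrableOn (fun x => mulDG (ζ i) w T x * partialDG i v T x) T.region := fun i =>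
    T.integrableOn (((hζ i).continuousOn_mulDG hΩ w T).mul continuousOn_const)
  rw [Finset.sum_congr rfl fun i _ => (integral_add (i1 i) (i2 i)).symm]
  refine Eq.trans (integral_congr_ae ?_) (integral_finsetSum _ fun i _ => (i1 i).add (i2 i))
  filter_upwards [ae_all_iff.2 fun i => (hζ i).weakPartial_mulDG hΩ v T i] with x hx
  simp only [brokenDiv, hx, Fin.sum_univ_two, mulDG, toBroken, partialDG]
  ring

theorem edgeIp_normalFlux (hΩ : IsConvexPolygonalDomain Ω) {ζ : Fin 2 → Plane → ℝ}
    (hζ : ∀ i, MemW1Inf Ω (ζ i)) (S : Finset M.Edge) {f g : M.Edge → Plane → ℝ}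
    (hf : ∀ e, ContinuousOn (f e) e.region) (hg : ∀ e, ContinuousOn (g e) e.region) :
    edgeIp S (fun e x => normalFlux ζ e x * f e x) g
      = ∑ i, edgeIp S (fun e x => contRep Ω (ζ i) x * e.normal i * f e x) g := by
  simp only [edgeIp]
  rw [Finset.sum_comm]
  refine Finset.sum_congr rfl fun e _ => ?_
  have hi : ∀ i, IntegrableOn (fun x => contRep Ω (ζ i) x * e.normal i * f e x * g e x) e.region
      (Measure.hausdorffMeasure 1) := fun i => e.integrableOn
    (((((hζ i).continuousOn_contRep_edge hΩ e).mul continuousOn_const).mul (hf e)).mul (hg e))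
  rw [← integral_finsetSum _ fun i _ => hi i]
  congr with x
  simp only [normalFlux, Finset.sum_mul]

/-- For each i, Gauss–Green removes the derivative from the test function; the edge terms [vw]
cancel and the centered flux remains. -/
theorem formAvgDiv_eq_formCentered (hΩ : IsConvexPolygonalDomain Ω) {ζ : Fin 2 → Plane → ℝ}
    (hζ : ∀ i, MemW1Inf Ω (ζ i)) (γ : Plane → ℝ) (v w : DGSpace M) :
    formAvgDiv ζ γ v w = formCentered ζ γ v w := by
  rw [formAvgDiv, formCentered, ip_avgDiv, ip_brokenDiv hΩ hζ,
    edgeIp_normalFlux hΩ hζ _ (fun e => continuousOn_jump (continuousOn_toBroken v) e)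
      (fun e => continuousOn_avg (continuousOn_toBroken w) e), ← Finset.sum_sub_distrib]
  congr 1
  refine Finset.sum_congr rfl fun i _ => ?_
  have hc := (hζ i).continuousOn_mulDG hΩ v
  rw [discretePartial_spec hc, discretePartial_spec hc, discretePartialRhs, discretePartialRhs]
  have h1 := (hζ i).gaussGreen hΩ v w i
  have h2 := (hζ i).edgeIp_traceQ_average hΩ i v w
  linarith

/-! ### Coercivity -/

theorem inflow_eq (ζ : Fin 2 → Plane → ℝ) (e : M.Edge) (x : Plane) :
    inflow ζ e x = (|normalFlux ζ e x| - normalFlux ζ e x) / 2 := by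
  rw [inflow, indicator_apply]
  split_ifs with h
  · have h' : normalFlux ζ e x < 0 := h
    rw [abs_of_neg h']
    ring
  · have h' : 0 ≤ normalFlux ζ e x := not_lt.1 h
    rw [abs_of_nonneg h']
    ring

theorem continuousOn_normalFlux (hΩ : IsConvexPolygonalDomain Ω) {ζ : Fin 2 → Plane → ℝ}
    (hζ : ∀ i, MemW1Inf Ω (ζ i)) (e : M.Edge) : ContinuousOn (normalFlux ζ e) e.region :=
  continuousOn_finsetSum _ fun i _ =>
    ((hζ i).continuousOn_contRep_edge hΩ e).mul continuousOn_const

/-- Integration by parts with equal arguments evaluates the sum of the + and - terms, so no interior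
edge term survives. By `inflow_eq`, ½ζ·n plus the inflow weight is ½|ζ·n|. -/
theorem formAvgDiv_self (hΩ : IsConvexPolygonalDomain Ω) {ζ : Fin 2 → Plane → ℝ}
    (hζ : ∀ i, MemW1Inf Ω (ζ i)) {γ : Plane → ℝ} (hγ : MemW1Inf Ω γ) (v : DGSpace M) :
    formAvgDiv ζ γ v v =
      ip (fun T x => (γ x - 1 / 2 * weakDiv Ω ζ x) * v T x) (toBroken v)
        + edgeIp M.bdryEdges (fun e x => 1 / 2 * |normalFlux ζ e x| * v e.triPlus x)
          (fun e x => v e.triPlus x) := by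
  have h1 : ∀ i, (1 / 2 : ℝ) *
      (ip (toBroken (discretePartial .plus i (mulDG (ζ i) v))) (toBroken v)
        + ip (toBroken (discretePartial .minus i (mulDG (ζ i) v))) (toBroken v))
      = 1 / 2 * ip (fun T x => weakPartial Ω i (ζ i) x * v T x) (toBroken v)
        + 1 / 2 * edgeIp M.bdryEdges (fun e x => contRep Ω (ζ i) x * e.normal i * v e.triPlus x)
            (fun e x => v e.triPlus x) := by
    intro i
    have h2 := (hζ i).integration_by_parts hΩ .plus i v v
    rw [ip_comm (toBroken v)] at h2
    have h3 : edgeIp M.bdryEdges (fun e x => contRep Ω (ζ i) x * v e.triPlus x)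
        (fun e x => v e.triPlus x * e.normal i)
        = edgeIp M.bdryEdges (fun e x => contRep Ω (ζ i) x * e.normal i * v e.triPlus x)
            (fun e x => v e.triPlus x) := by
      simp only [edgeIp]
      refine Finset.sum_congr rfl fun e _ => ?_
      congr with x
      ring
    rw [h3] at h2
    simp only [Side.flip] at h2
    linarith
  have hvc : ∀ e : M.Edge, ContinuousOn (fun x => v e.triPlus x) e.region := fun e =>
    (v _).continuous_plane.continuousOn
  have hvol : ∑ i, 1 / 2 * ip (fun T x => weakPartial Ω i (ζ i) x * v T x) (toBroken v)
      + ip (fun T x => (γ x - weakDiv Ω ζ x) * v T x) (toBroken v)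
      = ip (fun T x => (γ x - 1 / 2 * weakDiv Ω ζ x) * v T x) (toBroken v) := by
    simp only [ip, Finset.mul_sum]
    rw [Finset.sum_comm, ← Finset.sum_add_distrib]
    refine Finset.sum_congr rfl fun T _ => ?_
    have i1 : ∀ i, IntegrableOn (fun x => weakPartial Ω i (ζ i) x * (v T x * v T x)) T.region :=
      fun i => T.integrableOn_mul hΩ.interior_closure ((hζ i).memLp_weakPartial hΩ i)
        (continuousOn_mul_toBroken v v T)
    have i2 : IntegrableOn (fun x => γ x * (v T x * v T x)) T.region :=
      T.integrableOn_mul hΩ.interior_closure hγ.1 (continuousOn_mul_toBroken v v T)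
    have i3 : IntegrableOn (fun x => (γ x - weakDiv Ω ζ x) * v T x * toBroken v T x) T.region := by
      refine (i2.sub ((i1 0).add (i1 1))).congr (.of_forall fun x => ?_)
      simp only [weakDiv, Fin.sum_univ_two, toBroken, Pi.sub_apply, Pi.add_apply]
      ring
    simp_rw [← integral_const_mul]
    rw [← integral_finsetSum _ fun i _ => ?_, ← integral_add ?_ i3]
    · congr with x
      simp only [weakDiv, Fin.sum_univ_two, toBroken]
      ring
    · refine (((i1 0).add (i1 1)).const_mul (1 / 2)).congr (.of_forall fun x => ?_)
      simp only [Fin.sum_univ_two, toBroken, Pi.add_apply]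
      ring
    · refine ((i1 i).const_mul (1 / 2)).congr (.of_forall fun x => ?_)
      simp only [toBroken]
      ring
  have hedge : 1 / 2 * edgeIp M.bdryEdges (fun e x => normalFlux ζ e x * v e.triPlus x)
        (fun e x => v e.triPlus x)
      + edgeIp M.bdryEdges (fun e x => inflow ζ e x * v e.triPlus x) (fun e x => v e.triPlus x)
      = edgeIp M.bdryEdges (fun e x => 1 / 2 * |normalFlux ζ e x| * v e.triPlus x)
          (fun e x => v e.triPlus x) := by
    simp only [edgeIp, Finset.mul_sum]
    rw [← Finset.sum_add_distrib]
    refine Finset.sum_congr rfl fun e _ => ?_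
    have hfc := continuousOn_normalFlux hΩ hζ e
    rw [← integral_const_mul, ← integral_add]
    · congr with x
      rw [inflow_eq]
      ring
    · exact e.integrableOn (continuousOn_const.mul ((hfc.mul (hvc e)).mul (hvc e)))
    · simp_rw [inflow_eq]
      exact e.integrableOn ((((hfc.abs.sub hfc).div_const 2).mul (hvc e)).mul (hvc e))
  rw [formAvgDiv, ip_avgDiv, Finset.sum_congr rfl fun i _ => h1 i, Finset.sum_add_distrib,
    ← Finset.mul_sum (s := Finset.univ) (f := fun i => edgeIp M.bdryEdges _ _),
    ← edgeIp_normalFlux hΩ hζ _ hvc hvc, reactionInflow]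
  linarith

theorem exists_coercive (hΩ : IsConvexPolygonalDomain Ω) {ζ : Fin 2 → Plane → ℝ}
    (hζ : ∀ i, MemW1Inf Ω (ζ i)) {γ : Plane → ℝ} (hγ : MemW1Inf Ω γ) {γ₀ : ℝ} (h0 : 0 < γ₀)
    (h : ∀ᵐ x ∂(volume.restrict Ω), γ₀ ≤ γ x - 1 / 2 * weakDiv Ω ζ x) :
    ∃ C : ℝ, 0 < C ∧ ∀ (M : Mesh Ω) (v : DGSpace M),
      C * arNormSq ζ v ≤ formAvgDiv ζ γ v v := by
  -- γ₀ bounds the volume term, while the boundary term already occurs with coefficient 1.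
  refine ⟨min γ₀ 1, lt_min h0 one_pos, fun M v => ?_⟩
  rw [formAvgDiv_self hΩ hζ hγ, arNormSq, mul_add]
  have hv0 : 0 ≤ ip (toBroken v) (toBroken v) :=
    Finset.sum_nonneg fun T _ => integral_nonneg fun x => mul_self_nonneg _
  have he0 : 0 ≤ edgeIp M.bdryEdges (fun e x => 1 / 2 * |normalFlux ζ e x| * v e.triPlus x)
      (fun e x => v e.triPlus x) :=
    Finset.sum_nonneg fun e _ => integral_nonneg fun x => by
      simp only [Pi.zero_apply]
      rw [mul_assoc]
      exact mul_nonneg (by positivity) (mul_self_nonneg _)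
  refine add_le_add ((mul_le_mul_of_nonneg_right (min_le_left _ _) hv0).trans ?_)
    (mul_le_of_le_one_left he0 (min_le_right _ _))
  simp only [ip, Finset.mul_sum]
  refine Finset.sum_le_sum fun T _ => ?_
  rw [← integral_const_mul]
  have i1 : ∀ i, IntegrableOn (fun x => weakPartial Ω i (ζ i) x * (v T x * v T x)) T.region :=
    fun i => T.integrableOn_mul hΩ.interior_closure ((hζ i).memLp_weakPartial hΩ i)
      (continuousOn_mul_toBroken v v T)
  have i2 : IntegrableOn (fun x => γ x * (v T x * v T x)) T.region :=
    T.integrableOn_mul hΩ.interior_closure hγ.1 (continuousOn_mul_toBroken v v T)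
  refine integral_mono_ae
    ((T.integrableOn (continuousOn_mul_toBroken v v T)).const_mul γ₀) ?_ ?_
  · refine (i2.sub (((i1 0).add (i1 1)).const_mul (1 / 2))).congr (.of_forall fun x => ?_)
    simp only [weakDiv, Fin.sum_univ_two, toBroken, Pi.sub_apply, Pi.add_apply]
    ring
  · filter_upwards [T.ae_of_ae hΩ.interior_closure h] with x hx
    simp only [toBroken]
    rw [mul_assoc]
    exact mul_le_mul_of_nonneg_right hx (mul_self_nonneg _)

end DGCalc

end

theorem mainTheorem6 (Ω : Set DGCalc.Plane) (hΩ : DGCalc.IsConvexPolygonalDomain Ω)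
    (ζ : Fin 2 → DGCalc.Plane → ℝ) (hζ : ∀ i, DGCalc.MemW1Inf Ω (ζ i)) :
    -- generalized integration by parts
    (∀ (M : DGCalc.Mesh Ω) (s : DGCalc.Side) (i : Fin 2) (v φ : DGCalc.DGSpace M),
      DGCalc.ip (DGCalc.toBroken (DGCalc.discretePartial s i (DGCalc.mulDG (ζ i) v)))
          (DGCalc.toBroken φ) =
        -DGCalc.ip (DGCalc.toBroken (DGCalc.discretePartial s.flip i (DGCalc.mulDG (ζ i) φ)))
            (DGCalc.toBroken v)
          + DGCalc.ip (DGCalc.toBroken φ)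
              (fun T x => DGCalc.weakPartial Ω i (ζ i) x * v T x)
          + DGCalc.edgeIp M.bdryEdges
              (fun e x => DGCalc.contRep Ω (ζ i) x * φ e.triPlus x)
              (fun e x => v e.triPlus x * e.normal i)) ∧
    ∀ γ : DGCalc.Plane → ℝ, DGCalc.MemW1Inf Ω γ →
      -- the scheme is the centered-flux DG method
      (∀ M : DGCalc.Mesh Ω,
        (∀ v w : DGCalc.DGSpace M, DGCalc.formAvgDiv ζ γ v w = DGCalc.formCentered ζ γ v w) ∧
        ∀ f g : DGCalc.Plane → ℝ, MemLp f 2 (volume.restrict Ω) →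
          IntegrableOn g (frontier Ω) (Measure.hausdorffMeasure 1) →
          ∀ u : DGCalc.DGSpace M,
            (∀ w : DGCalc.DGSpace M, DGCalc.formAvgDiv ζ γ u w = DGCalc.load ζ f g w) ↔
              ∀ w : DGCalc.DGSpace M, DGCalc.formCentered ζ γ u w = DGCalc.load ζ f g w) ∧
      -- coercivity, with a constant that does not depend on the mesh
      ∀ γ₀ : ℝ, 0 < γ₀ →
        (∀ᵐ x ∂(volume.restrict Ω), γ₀ ≤ γ x - 1 / 2 * DGCalc.weakDiv Ω ζ x) →
        ∃ C : ℝ, 0 < C ∧ ∀ (M : DGCalc.Mesh Ω) (v : DGCalc.DGSpace M),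
          C * DGCalc.arNormSq ζ v ≤ DGCalc.formAvgDiv ζ γ v v := by
  refine ⟨fun M s i v φ => (hζ i).integration_by_parts hΩ s i v φ, fun γ hγ => ⟨fun M => ?_, ?_⟩⟩
  · have h := DGCalc.formAvgDiv_eq_formCentered (M := M) hΩ hζ γ
    exact ⟨h, fun f g _ _ u => by simp only [h]⟩
  · exact fun γ₀ h0 h => DGCalc.exists_coercive hΩ hζ hγ h0 h
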